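/- Write $\mathbb Z^2\subset\mathbb R^2$ for the lattice in the plane; a covector $\lambda=(a,b)\in\mathbb Z^2$ acts by $\lambda(x,y)=ax+by$, and an integer vector or covector is primitive if its coordinates are coprime. The tropical length of a segment $[p,p+su]$ with $s\ge 0$ and $u$ a primitive integer vector is $s$. Let $\Phi\subset\mathbb R^2$ be a compact convex set with nonempty interior. For $t\ge 0$ put $$\Phi(t)=\Bigl\{p\in\mathbb R^2 : \lambda(p)\ge \min_{q\in\Phi}\lambda(q)+t\ \text{ for all primitive covectors } \lambda\Bigr\}.$$ The final time $t_\Phi$ is the minimal $t\ge 0$ such that $\Phi(t)$ has empty interior; the final locus $\Phi(t_\Phi)$ is a point or a segment of rational slope, and $\operatorname{l}(\Phi(t_\Phi))$ denotes its tropical length ($0$ for a point). For a convex polygon $P$ with sides of rational slope and nonempty interior, $\operatorname{l}(\partial P)$ is the sum of the tropical lengths of its sides. The caustic $\mathcal K_P$ is the union of the vertices of all polygons $P(t)$, $0<t<t_P$, and of the final locus $P(t_P)$; its edges outside the final locus are the trajectories of the vertices that lie between two given sides. A vertex between adjacent sides with primitive inner conormals $\lambda,\mu$ has as weight the lattice length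 (the greatest common divisor of the coordinates) of $\lambda-\mu$, which is constant along an edge, and the points of $P(t_P)$ have weight $2$. The caustic length $\operatorname{l}(\mathcal K_P)$ is the sum of the tropical lengths of the edges of $\mathcal K_P$, each multiplied by its weight. For $0<t<t_\Phi$ the set $\Phi(t)$ is such a polygon. Then the limits $$\operatorname{l}(\mathcal K_\Phi)=\lim_{t\to 0^+}\operatorname{l}(\mathcal K_{\Phi(t)}),\qquad \operatorname{l}(\partial\Phi)=\lim_{t\to 0^+}\operatorname{l}(\partial\Phi(t))$$ exist and are finite, and $$\operatorname{l}(\mathcal K_\Phi)+\operatorname{l}(\partial\Phi)=12\,t_\Phi+4\operatorname{l}(\Phi(t_\Phi)).$$ -/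

import Mathlib

open Filter Topology

noncomputable section

namespace Tropical2D

/-- The tropical plane `N ⊗ ℝ`, in coordinates given by a basis of the lattice `N`. -/
abbrev Plane : Type := ℝ × ℝ

/-- The lattice `N = ℤ²` of the plane, or, in the dual basis, the dual lattice `M = Hom(N, ℤ)`. -/
abbrev Lattice : Type := ℤ × ℤ

/-- Primitive (nonzero, indivisible) lattice elements. -/
def IsPrimitive (v : Lattice) : Prop := Int.gcd v.1 v.2 = 1

/-- The value `m(p)` of a covector `m ∈ M` at a point `p`. -/
def pairing (m : Lattice) (p : Plane) : ℝ := (m.1 : ℝ) * p.1 + (m.2 : ℝ) * p.2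

/-- The real vector of the plane underlying a lattice vector of `N`. -/
def toPlane (u : Lattice) : Plane := ((u.1 : ℝ), (u.2 : ℝ))

/-- The determinant `m ∧ n`. -/
def det (m n : Lattice) : ℤ := m.1 * n.2 - m.2 * n.1

/-- `{p | c ≤ m(p)}` is a support half-plane of `Φ` of rational slope `m`: it contains `Φ`, and its
boundary line `{p | m(p) = c}` meets `Φ`. -/
def IsSupportHalfPlane (Φ : Set Plane) (m : Lattice) (c : ℝ) : Prop :=
  IsPrimitive m ∧ (∀ p ∈ Φ, c ≤ pairing m p) ∧ ∃ p ∈ Φ, pairing m p = c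

/-- The tropical propagation `Φ(t)`: every support half-plane `{p | c ≤ m(p)}` of rational slope is
moved to `{p | c + t ≤ m(p)}`, and the results are intersected. -/
def propagation (Φ : Set Plane) (t : ℝ) : Set Plane :=
  {p | ∀ (m : Lattice) (c : ℝ), IsSupportHalfPlane Φ m c → c + t ≤ pairing m p}

/-- The final time `t_Φ`: the minimal `t ≥ 0` such that `Φ(t)` has empty interior
(there is such a time for every compact `Φ`). -/
def finalTime (Φ : Set Plane) : ℝ := sInf {t : ℝ | 0 ≤ t ∧ interior (propagation Φ t) = ∅}

/-- The final locus `Φ(t_Φ)`. -/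
def finalLocus (Φ : Set Plane) : Set Plane := propagation Φ (finalTime Φ)

/-- The tropical length of a point or of a bounded interval `S` of rational slope: the largest
tropical distance `s` of two points `p` and `p + s u` of `S`, where `u` is a primitive integer
vector. -/
def tropicalLength (S : Set Plane) : ℝ :=
  sSup {s : ℝ | ∃ u : Lattice, IsPrimitive u ∧ ∃ p ∈ S, p + s • toPlane u ∈ S}

/-- The face of `P` on which the covector `m` is minimal. -/
def face (P : Set Plane) (m : Lattice) : Set Plane :=
  {p | p ∈ P ∧ ∀ q ∈ P, pairing m p ≤ pairing m q}

/-- The polygonal domain `P` has a side of slope `m`; the side is then `face P m`, and `m` is its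
primitive inner conormal. -/
def IsSide (P : Set Plane) (m : Lattice) : Prop := IsPrimitive m ∧ (face P m).Nontrivial

/-- The tropical perimeter of a polygon with rational slopes and nonempty interior: the sum of the
tropical lengths of its sides. (A face that is not a side is at most a point and has length `0`.) -/
def perimeter (P : Set Plane) : ℝ :=
  ∑ᶠ (m : Lattice) (_ : IsSide P m), tropicalLength (face P m)

/-- `p` is the vertex of `P` at which the sides of slopes `m` and `n` meet, where `n` comes after
`m` in counterclockwise order. The cone of the dual fan at `p` is spanned by `m` and `n`. -/
def IsVertexBetween (P : Set Plane) (m n : Lattice) (p : Plane) : Prop :=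
  IsSide P m ∧ IsSide P n ∧ 0 < det m n ∧ p ∈ face P m ∧ p ∈ face P n

/-- The trajectory of the vertex between the sides of slopes `m` and `n`, over all the wave fronts
`Φ(t)` with `0 < t < t_Φ`. The nonempty ones are the edges of the caustic outside the final locus;
they are pairwise disjoint. -/
def causticEdge (Φ : Set Plane) (m n : Lattice) : Set Plane :=
  {p | ∃ t : ℝ, 0 < t ∧ t < finalTime Φ ∧ IsVertexBetween (propagation Φ t) m n p}

/-- The tropical caustic: the vertices of all `Φ(t)`, `0 < t < t_Φ`, and the final locus. -/
def caustic (Φ : Set Plane) : Set Plane :=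
  (⋃ (m : Lattice) (n : Lattice), causticEdge Φ m n) ∪ finalLocus Φ

/-- The width of the cone spanned by `m` and `n`, that is the lattice length of `m - n`. A vertex
of type `A_k` of a wave front is one whose dual cone has height `1` and width `k + 1`, and the
weight of such a vertex is `k + 1`. -/
def width (m n : Lattice) : ℕ := Int.gcd (m.1 - n.1) (m.2 - n.2)

/-- The weighted tropical length of the caustic of a polygon with rational slopes and nonempty
interior: the sum of the tropical lengths of all its edges, each multiplied by its weight.
The final locus has weight `2`. -/
def causticLength (Φ : Set Plane) : ℝ :=
  (∑ᶠ e : Lattice × Lattice, (width e.1 e.2 : ℝ) * tropicalLength (causticEdge Φ e.1 e.2)) +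
    2 * tropicalLength (finalLocus Φ)

end Tropical2D

end

/-!
Let `h m` be the minimum of a covector `m` on `Φ` and write `T` for the final time. For `0 < t < T`
a primitive covector is called *tight* at time `t` if its minimum on the wave front `Φ(t)` is
exactly `h m + t`; let `N t` be the number of tight covectors.

* A long primitive covector is a sum of two shorter ones on which `h` is almost additive, so only
  finitely many covectors matter at a positive time (`IsBody.exists_normSq_bound`): `Φ(t)` is a
  polygon and `N t` is finite. Superadditivity of `h` shows that two covectors that are tight at a
  common point span a triangle with no lattice points below its edge opposite to the origin
  (`IsBody.le_add_of_tight`). Hence the tight covectors are the rays of a smooth complete fan that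
  refines the normal fan of `Φ(t)` (`IsBody.isSmoothFan_tights`), wave fronts of wave fronts are
  wave fronts (`IsBody.propagation_propagation`), and no side and no tight covector is ever born.

* While the tight covectors do not change, the length of the side of a tight covector `m` changes at
  the rate `a - 2`, where `m₋ + m₊ = a m` for its neighbours in the fan. The sum of the numbers
  `3 - a` over a smooth fan is `12` (`IsSmoothFan.sum_det_next`), so the perimeter changes at the
  rate `N t - 12`. For the sum, write `a` as `(z₋ + z₊) / z` with Gaussian integers; this turns the
  sum into a sum over cones whose terms are additive under subdivision, and any two smooth fans have
  a common refinement.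

* The vertices move at unit tropical speed, and between combinatorial changes the tight covectors
  that belong to a vertex are the lattice points of a half-open segment, as many as the weight of
  the vertex (`IsBody.card_inCone_eq_width`). So the part of the caustic outside the final locus is
  swept at the rate `N t`.

Therefore the perimeter plus the length still to be swept decreases at the constant rate `12`. At
the final time nothing is left to be swept, and the perimeter of the degenerate polygon `Φ(T)` is
twice its length (`Adapted.perimeter_of_interior_eq_empty`); the final locus itself contributes the
other two lengths to the caustic. As the swept length is monotone in `t`, and bounded because the
perimeter is nonnegative, both limits exist.
-/

namespace Tropical2D

/-! ### Lattice vectors and determinants -/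

theorem det_swap (m n : Lattice) : det n m = -det m n := by
  simp only [det]; ring

theorem det_self (m : Lattice) : det m m = 0 := by
  simp only [det]; ring

theorem det_add_left (a b c : Lattice) : det (a + b) c = det a c + det b c := by
  simp only [det, Prod.fst_add, Prod.snd_add]; ring

theorem det_add_right (a b c : Lattice) : det a (b + c) = det a b + det a c := by
  simp only [det, Prod.fst_add, Prod.snd_add]; ring

theorem det_smul_left (k : ℤ) (a b : Lattice) : det (k • a) b = k * det a b := by
  simp only [det, Prod.smul_fst, Prod.smul_snd, smul_eq_mul]; ring

theorem det_smul_right (k : ℤ) (a b : Lattice) : det a (k • b) = k * det a b := by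
  simp only [det, Prod.smul_fst, Prod.smul_snd, smul_eq_mul]; ring

/-- Cramer's rule: the coordinates of `k` with respect to `m` and `n`. -/
theorem det_smul_eq (m n k : Lattice) : det m n • k = det k n • m + det m k • n := by
  ext <;> simp only [det, Prod.fst_add, Prod.snd_add, Prod.smul_fst, Prod.smul_snd, smul_eq_mul] <;>
    ring

theorem det_plucker (a b c d : Lattice) :
    det a c * det b d = det a b * det c d + det a d * det b c := by
  simp only [det]; ring

theorem pairing_add_left (m n : Lattice) (p : Plane) :
    pairing (m + n) p = pairing m p + pairing n p := by
  simp only [pairing, Prod.fst_add, Prod.snd_add]; push_cast; ring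

theorem pairing_smul_left (k : ℤ) (m : Lattice) (p : Plane) :
    pairing (k • m) p = k * pairing m p := by
  simp only [pairing, Prod.smul_fst, Prod.smul_snd, smul_eq_mul]; push_cast; ring

theorem pairing_neg_left (m : Lattice) (p : Plane) : pairing (-m) p = -pairing m p := by
  simp only [pairing, Prod.fst_neg, Prod.snd_neg]; push_cast; ring

theorem pairing_add_right (m : Lattice) (p q : Plane) :
    pairing m (p + q) = pairing m p + pairing m q := by
  simp only [pairing, Prod.fst_add, Prod.snd_add]; ring

theorem pairing_sub_right (m : Lattice) (p q : Plane) :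
    pairing m (p - q) = pairing m p - pairing m q := by
  simp only [pairing, Prod.fst_sub, Prod.snd_sub]; ring

theorem pairing_smul_right (m : Lattice) (r : ℝ) (p : Plane) :
    pairing m (r • p) = r * pairing m p := by
  simp only [pairing, Prod.smul_fst, Prod.smul_snd, smul_eq_mul]; ring

theorem pairing_neg_right (m : Lattice) (p : Plane) : pairing m (-p) = -pairing m p := by
  simp only [pairing, Prod.fst_neg, Prod.snd_neg]; ring

theorem continuous_pairing (m : Lattice) : Continuous (pairing m) := by
  unfold pairing; fun_prop

theorem det_mul_pairing (m n k : Lattice) (p : Plane) :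
    (det m n : ℝ) * pairing k p = det k n * pairing m p + det m k * pairing n p := by
  simp only [det, pairing]; push_cast; ring

/-- Two points at which two independent covectors agree are equal. -/
theorem eq_of_pairing_eq {m n : Lattice} (h : det m n ≠ 0) {p q : Plane}
    (hm : pairing m p = pairing m q) (hn : pairing n p = pairing n q) : p = q := by
  have h' : (m.1 : ℝ) * n.2 - m.2 * n.1 ≠ 0 := by
    have : ((det m n : ℤ) : ℝ) ≠ 0 := by exact_mod_cast h
    simpa [det] using this
  simp only [pairing] at hm hn
  ext
  · apply mul_left_cancel₀ h'
    linear_combination (n.2 : ℝ) * hm - (m.2 : ℝ) * hn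
  · apply mul_left_cancel₀ h'
    linear_combination (m.1 : ℝ) * hn - (n.1 : ℝ) * hm

/-- The vector along the level lines of `m`, in the direction in which a covector `n` with
`0 < det m n` decreases. -/
def turn (m : Lattice) : Lattice := (m.2, -m.1)

theorem pairing_turn (m n : Lattice) : pairing n (toPlane (turn m)) = -(det m n : ℝ) := by
  simp only [pairing, toPlane, turn, det]; push_cast; ring

theorem IsPrimitive.ne_zero {m : Lattice} (h : IsPrimitive m) : m ≠ 0 := by
  rintro rfl; simp [IsPrimitive] at h

theorem IsPrimitive.neg {m : Lattice} (h : IsPrimitive m) : IsPrimitive (-m) := by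
  simpa [IsPrimitive] using h

theorem IsPrimitive.turn {m : Lattice} (h : IsPrimitive m) : IsPrimitive (turn m) := by
  simpa [IsPrimitive, Tropical2D.turn, Int.gcd_comm] using h

theorem isPrimitive_of_det_eq_one {m n : Lattice} (h : det m n = 1) : IsPrimitive m := by
  unfold IsPrimitive
  rw [← Int.isCoprime_iff_gcd_eq_one]
  exact ⟨n.2, -n.1, by simp only [det] at h; linarith⟩

theorem isPrimitive_of_det_eq_one' {m n : Lattice} (h : det m n = 1) : IsPrimitive n := by
  unfold IsPrimitive
  rw [← Int.isCoprime_iff_gcd_eq_one]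
  exact ⟨-m.2, m.1, by simp only [det] at h; linarith⟩

theorem IsPrimitive.exists_det_eq_one {m : Lattice} (h : IsPrimitive m) :
    ∃ n : Lattice, det m n = 1 := by
  unfold IsPrimitive at h
  rw [← Int.isCoprime_iff_gcd_eq_one] at h
  obtain ⟨a, b, hab⟩ := h
  exact ⟨(-b, a), by simp only [det]; linarith⟩

theorem IsPrimitive.isUnit_of_eq_smul {m n : Lattice} (h : IsPrimitive m) {k : ℤ}
    (hk : m = k • n) : IsUnit k := by
  obtain ⟨a, ha⟩ := h.exists_det_eq_one
  rw [hk, det_smul_left] at ha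
  exact IsUnit.of_mul_eq_one _ ha

theorem IsPrimitive.exists_eq_smul {m n : Lattice} (h : IsPrimitive m) (hd : det m n = 0) :
    ∃ k : ℤ, n = k • m := by
  obtain ⟨a, ha⟩ := h.exists_det_eq_one
  have := det_smul_eq m a n
  rw [ha, hd, one_smul, zero_smul, add_zero] at this
  exact ⟨_, this⟩

theorem eq_or_eq_neg_of_det_eq_zero {m n : Lattice} (hm : IsPrimitive m) (hn : IsPrimitive n)
    (hd : det m n = 0) : n = m ∨ n = -m := by
  obtain ⟨k, hk⟩ := hm.exists_eq_smul hd
  rcases Int.isUnit_iff.1 (hn.isUnit_of_eq_smul hk) with rfl | rfl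
  · left; simpa using hk
  · right; simpa using hk

/-- The vectors `n` with `det m n = 1` differ by multiples of `m`, so one of them is reduced with
respect to a given `l`. -/
theorem IsPrimitive.exists_det_eq_one_of_det_pos {m l : Lattice} (h : IsPrimitive m)
    (hd : 0 < det m l) : ∃ n : Lattice, det m n = 1 ∧ 0 ≤ det n l ∧ det n l < det m l := by
  obtain ⟨a, ha⟩ := h.exists_det_eq_one
  refine ⟨a + (-(det a l / det m l)) • m, ?_, ?_, ?_⟩
  · rw [det_add_right, det_smul_right, det_self, ha]; ring
  · rw [det_add_left, det_smul_left]
    have := Int.emod_nonneg (det a l) hd.ne'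
    rw [Int.emod_def] at this
    linarith
  · rw [det_add_left, det_smul_left]
    have := Int.emod_lt_of_pos (det a l) hd
    rw [Int.emod_def] at this
    linarith

/-- In a finite set of covectors that are positive on a common vector there is a last one in
counterclockwise order. -/
theorem exists_last (X : Finset Lattice) (hX : X.Nonempty) (w : Plane)
    (hw : ∀ u ∈ X, 0 < pairing u w) : ∃ n ∈ X, ∀ k ∈ X, det n k ≤ 0 := by
  obtain ⟨n, hn, hmax⟩ := X.exists_max_image
    (fun u => (-(u.1 : ℝ) * w.2 + u.2 * w.1) / pairing u w) hX
  refine ⟨n, hn, fun k hk => ?_⟩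
  have h1 := hmax k hk
  have hn0 := hw n hn
  have hk0 := hw k hk
  rw [div_le_div_iff₀ hk0 hn0] at h1
  have hw2 : 0 < w.1 ^ 2 + w.2 ^ 2 := by
    by_contra hcon
    have e1 : w.1 = 0 := by nlinarith [sq_nonneg w.1, sq_nonneg w.2]
    have e2 : w.2 = 0 := by nlinarith [sq_nonneg w.1, sq_nonneg w.2]
    simp [pairing, e1, e2] at hn0
  have h2 : (det n k : ℝ) * (w.1 ^ 2 + w.2 ^ 2) ≤ 0 := by
    simp only [det, pairing] at *
    push_cast
    nlinarith
  have h3 : (det n k : ℝ) ≤ 0 := by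
    by_contra hcon
    push Not at hcon
    nlinarith [mul_pos hcon hw2]
  exact_mod_cast h3

/-- In a finite set of covectors that are positive on a common vector there is a first one in
counterclockwise order. -/
theorem exists_first (X : Finset Lattice) (hX : X.Nonempty) (w : Plane)
    (hw : ∀ u ∈ X, 0 < pairing u w) : ∃ n ∈ X, ∀ k ∈ X, 0 ≤ det n k := by
  classical
  -- The reflection `(a, b) ↦ (a, -b)` reverses the orientation.
  obtain ⟨n, hn, h⟩ := exists_last (X.image fun u => (u.1, -u.2)) (hX.image _) (w.1, -w.2) (by
    intro u hu
    obtain ⟨v, hv, rfl⟩ := Finset.mem_image.1 hu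
    have := hw v hv
    simp only [pairing] at *
    push_cast
    linarith)
  obtain ⟨v, hv, rfl⟩ := Finset.mem_image.1 hn
  refine ⟨v, hv, fun k hk => ?_⟩
  have := h _ (Finset.mem_image_of_mem _ hk)
  simp only [det] at *
  linarith

/-! ### Complete fans -/

/-- `n` comes next after `m` in the counterclockwise order of the rays of `S`, less than half a turn
further on. -/
def IsNext (S : Finset Lattice) (m n : Lattice) : Prop :=
  m ∈ S ∧ n ∈ S ∧ 0 < det m n ∧ ∀ k ∈ S, ¬(0 < det m k ∧ 0 < det k n)

/-- The primitive generators of the rays of a complete fan: every ray is followed by another one at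
an angle of less than half a turn. -/
structure IsFan (S : Finset Lattice) : Prop where
  nonempty : S.Nonempty
  primitive : ∀ m ∈ S, IsPrimitive m
  exists_next : ∀ m ∈ S, ∃ n, IsNext S m n

/-- `k` lies in the half-open cone that contains the ray of `m` but not that of `n`. -/
def InCone (m n k : Lattice) : Prop := 0 ≤ det m k ∧ 0 < det k n

instance (m n k : Lattice) : Decidable (InCone m n k) :=
  inferInstanceAs (Decidable (_ ∧ _))

theorem InCone.eq_or_det_pos {m n k : Lattice} (hm : IsPrimitive m) (hk : IsPrimitive k)
    (hmn : 0 < det m n) (h : InCone m n k) : k = m ∨ 0 < det m k := by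
  rcases h.1.eq_or_lt with h0 | h0
  · rcases eq_or_eq_neg_of_det_eq_zero hm hk h0.symm with rfl | rfl
    · exact Or.inl rfl
    · have := h.2
      simp only [det, Prod.fst_neg, Prod.snd_neg] at this hmn
      linarith
  · exact Or.inr h0

namespace IsFan

variable {S : Finset Lattice}

theorem next_unique (hS : IsFan S) {m n n' : Lattice} (h : IsNext S m n) (h' : IsNext S m n') :
    n = n' := by
  rcases lt_trichotomy (det n n') 0 with hlt | heq | hgt
  · exact (h.2.2.2 n' h'.2.1 ⟨h'.2.2.1, by rw [det_swap]; linarith⟩).elim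
  · rcases eq_or_eq_neg_of_det_eq_zero (hS.primitive _ h.2.1) (hS.primitive _ h'.2.1) heq with e | e
    · exact e.symm
    · have h1 := h.2.2.1
      have h2 := h'.2.2.1
      rw [e] at h2
      simp only [det, Prod.fst_neg, Prod.snd_neg] at h1 h2
      linarith
  · exact (h'.2.2.2 n h.2.1 ⟨h.2.2.1, hgt⟩).elim

theorem prev_unique (hS : IsFan S) {m m' n : Lattice} (h : IsNext S m n) (h' : IsNext S m' n) :
    m = m' := by
  rcases lt_trichotomy (det m m') 0 with hlt | heq | hgt
  · exact (h'.2.2.2 m h.1 ⟨by rw [det_swap]; linarith, h.2.2.1⟩).elim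
  · rcases eq_or_eq_neg_of_det_eq_zero (hS.primitive _ h.1) (hS.primitive _ h'.1) heq with e | e
    · exact e.symm
    · have h1 := h.2.2.1
      have h2 := h'.2.2.1
      rw [e] at h2
      simp only [det, Prod.fst_neg, Prod.snd_neg] at h1 h2
      linarith
  · exact (h.2.2.2 m' h'.1 ⟨hgt, h'.2.2.1⟩).elim

/-- The rays of a complete fan are not contained in a closed half-plane. -/
theorem exists_pairing_pos (hS : IsFan S) {w : Plane} (hw : w ≠ 0) :
    ∃ u ∈ S, 0 < pairing u w := by
  classical
  by_contra hcon
  push Not at hcon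
  rcases (S.filter fun u => pairing u w < 0).eq_empty_or_nonempty with hZ | hZ
  · have hz : ∀ u ∈ S, pairing u w = 0 := fun u hu => by
      by_contra h0
      have : u ∈ S.filter fun u => pairing u w < 0 :=
        Finset.mem_filter.2 ⟨hu, lt_of_le_of_ne (hcon u hu) h0⟩
      simp [hZ] at this
    obtain ⟨u, hu⟩ := hS.nonempty
    obtain ⟨n, hn⟩ := hS.exists_next u hu
    refine hw (eq_of_pairing_eq hn.2.2.1.ne' ?_ ?_)
    · rw [hz u hu]; simp [pairing]
    · rw [hz n hn.2.1]; simp [pairing]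
  · obtain ⟨y, hy, hlast⟩ := exists_last _ hZ (-w) (fun u hu => by
      rw [pairing_neg_right]; linarith [(Finset.mem_filter.1 hu).2])
    obtain ⟨hyS, hyw⟩ := Finset.mem_filter.1 hy
    obtain ⟨n, hn⟩ := hS.exists_next y hyS
    have hn0 : pairing n w = 0 := by
      by_contra h0
      have := hlast n (Finset.mem_filter.2 ⟨hn.2.1, lt_of_le_of_ne (hcon n hn.2.1) h0⟩)
      linarith [hn.2.2.1]
    obtain ⟨n', hn'⟩ := hS.exists_next n hn.2.1
    have h1 := det_mul_pairing y n n' w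
    rw [hn0, mul_zero, add_zero, det_swap n n'] at h1
    have h2 := hcon n' hn'.2.1
    have h3 : (0 : ℝ) < det y n := by exact_mod_cast hn.2.2.1
    have h4 : (0 : ℝ) < det n n' := by exact_mod_cast hn'.2.2.1
    push_cast at h1
    nlinarith [mul_pos h4 (neg_pos.2 hyw), mul_nonneg h3.le (neg_nonneg.2 h2)]

/-- There is a step of the fan across every line, in each of the two directions. -/
theorem exists_next_crossing (hS : IsFan S) {w : Plane} (hw : w ≠ 0) :
    ∃ m n, IsNext S m n ∧ 0 < pairing m w ∧ pairing n w ≤ 0 := by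
  classical
  obtain ⟨u, hu, huw⟩ := hS.exists_pairing_pos hw
  obtain ⟨m, hm, hlast⟩ := exists_last (S.filter fun u => 0 < pairing u w)
    ⟨u, Finset.mem_filter.2 ⟨hu, huw⟩⟩ w (fun u hu => (Finset.mem_filter.1 hu).2)
  obtain ⟨hmS, hmw⟩ := Finset.mem_filter.1 hm
  obtain ⟨n, hn⟩ := hS.exists_next m hmS
  refine ⟨m, n, hn, hmw, ?_⟩
  by_contra hcon
  push Not at hcon
  have := hlast n (Finset.mem_filter.2 ⟨hn.2.1, hcon⟩)
  linarith [hn.2.2.1]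

/-- The cones of a complete fan cover the plane. -/
theorem exists_inCone (hS : IsFan S) {k : Lattice} (hk : k ≠ 0) :
    ∃ m n, IsNext S m n ∧ InCone m n k := by
  have key : ∀ u : Lattice, pairing u (toPlane (turn k)) = (det u k : ℝ) := fun u => by
    rw [pairing_turn, det_swap]; push_cast; ring
  have hw : toPlane (turn k) ≠ 0 := by
    intro h0
    apply hk
    simp only [toPlane, turn, Prod.mk_eq_zero] at h0
    ext
    · have := h0.2; push_cast at this; simp at this; exact_mod_cast this
    · exact_mod_cast h0.1
  obtain ⟨m, n, hn, h1, h2⟩ := hS.exists_next_crossing hw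
  rw [key] at h1 h2
  have h1' : 0 < det m k := by exact_mod_cast h1
  have h2' : det n k ≤ 0 := by exact_mod_cast h2
  rcases h2'.lt_or_eq with hlt | heq
  · exact ⟨m, n, hn, h1'.le, by rw [det_swap]; linarith⟩
  · -- `k` is on the ray of `n`, so it belongs to the cone after `n`.
    obtain ⟨n', hn'⟩ := hS.exists_next n hn.2.1
    refine ⟨n, n', hn', heq.ge, ?_⟩
    have := det_plucker m k n n'
    have e1 : det m n * det k n' = det m k * det n n' + det m n' * det k n := this
    rw [det_swap n k, heq, neg_zero, mul_zero, add_zero] at e1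
    have : 0 < det m n * det k n' := by rw [e1]; exact mul_pos h1' hn'.2.2.1
    exact pos_of_mul_pos_right this hn.2.2.1.le

theorem inCone_unique (hS : IsFan S) {m n m' n' k : Lattice} (h : IsNext S m n)
    (h' : IsNext S m' n') (hk : InCone m n k) (hk' : InCone m' n' k) : m = m' := by
  have aux : ∀ {m n m' n' : Lattice}, IsNext S m n → IsNext S m' n' → InCone m n k →
      InCone m' n' k → ¬ 0 < det m m' := by
    intro m n m' n' h h' hk hk' hpos
    have e : det m k * det m' n = det m m' * det k n + det m n * det m' k := det_plucker m m' k n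
    have : 0 < det m k * det m' n := by
      rw [e]
      have := mul_pos hpos hk.2
      have := mul_nonneg h.2.2.1.le hk'.1
      linarith
    exact h.2.2.2 m' h'.1 ⟨hpos, pos_of_mul_pos_right this hk.1⟩
  rcases lt_trichotomy (det m m') 0 with hlt | heq | hgt
  · exact (aux h' h hk' hk (by rw [det_swap]; linarith)).elim
  · rcases eq_or_eq_neg_of_det_eq_zero (hS.primitive _ h.1) (hS.primitive _ h'.1) heq with e | e
    · exact e.symm
    · have h1 := hk.1
      have h2 := hk'.1
      have hmk : det m k = 0 := by
        rw [e] at h2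
        simp only [det, Prod.fst_neg, Prod.snd_neg] at h1 h2 ⊢
        linarith
      obtain ⟨c, rfl⟩ := (hS.primitive _ h.1).exists_eq_smul hmk
      have a1 := hk.2
      have a2 := hk'.2
      rw [det_smul_left] at a1 a2
      have b1 := h.2.2.1
      have b2 := h'.2.2.1
      rw [show m = -m' by rw [e]; simp] at a2
      rw [show det (-m') n' = -det m' n' by simp only [det, Prod.fst_neg, Prod.snd_neg]; ring] at a2
      have c1 : 0 < c := pos_of_mul_pos_left a1 b1.le
      nlinarith
  · exact (aux h h' hk hk' hgt).elim

theorem exists_next_fun (hS : IsFan S) : ∃ nx : Lattice → Lattice, ∀ m ∈ S, IsNext S m (nx m) := by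
  classical
  exact ⟨fun m => if h : m ∈ S then (hS.exists_next m h).choose else 0, fun m hm => by
    simpa [hm] using (hS.exists_next m hm).choose_spec⟩

/-- A sum over nonzero vectors can be arranged by the cones of a complete fan. -/
theorem sum_sum_inCone {M : Type*} [AddCommMonoid M] (hS : IsFan S) {nx : Lattice → Lattice}
    (hnx : ∀ m ∈ S, IsNext S m (nx m)) (L : Finset Lattice) (hL : ∀ k ∈ L, k ≠ 0)
    (f : Lattice → M) :
    ∑ m ∈ S, ∑ k ∈ L with InCone m (nx m) k, f k = ∑ k ∈ L, f k := by
  simp only [Finset.sum_filter]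
  rw [Finset.sum_comm]
  refine Finset.sum_congr rfl fun k hk => ?_
  obtain ⟨m, n, hn, hc⟩ := hS.exists_inCone (hL k hk)
  have hnm : n = nx m := hS.next_unique hn (hnx m hn.1)
  subst hnm
  rw [Finset.sum_eq_single_of_mem m hn.1, if_pos hc]
  intro m' hm' hne
  rw [if_neg]
  exact fun hc' => hne (hS.inCone_unique (hnx m' hm') hn hc' hc)

/-- Passing to the next ray permutes the rays. -/
theorem sum_next {M : Type*} [AddCommMonoid M] (hS : IsFan S) {nx : Lattice → Lattice}
    (hnx : ∀ m ∈ S, IsNext S m (nx m)) (f : Lattice → M) :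
    ∑ m ∈ S, f (nx m) = ∑ m ∈ S, f m := by
  have hmaps : ∀ m ∈ S, nx m ∈ S := fun m hm => (hnx m hm).2.1
  have hinj : Set.InjOn nx S := fun a ha b hb hab =>
    hS.prev_unique (hnx a ha) (by rw [hab]; exact hnx b hb)
  refine Finset.sum_nbij nx hmaps hinj ?_ fun _ _ => rfl
  exact (Finset.surjOn_of_injOn_of_card_le nx hmaps hinj le_rfl)

end IsFan

/-! ### Smooth fans and the number twelve -/

/-- A complete fan all of whose cones are unimodular. -/
structure IsSmoothFan (S : Finset Lattice) : Prop extends IsFan S where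
  det_eq_one : ∀ m n, IsNext S m n → det m n = 1

/-- A lattice vector as a Gaussian integer. -/
def toComplex (u : Lattice) : ℂ := ⟨u.1, u.2⟩

theorem toComplex_ne_zero {u : Lattice} (h : u ≠ 0) : toComplex u ≠ 0 := by
  intro h0
  apply h
  have h1 := congrArg Complex.re h0
  have h2 := congrArg Complex.im h0
  simp only [toComplex, Complex.zero_re, Complex.zero_im, Int.cast_eq_zero] at h1 h2
  exact Prod.ext h1 h2

theorem toComplex_add (u v : Lattice) : toComplex (u + v) = toComplex u + toComplex v := by
  apply Complex.ext <;> simp [toComplex]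

theorem toComplex_smul (k : ℤ) (v : Lattice) : toComplex (k • v) = k * toComplex v := by
  apply Complex.ext <;> simp [toComplex]

/-- The contribution of a unimodular cone to the sum `∑ (a - 3)` over the rays of a smooth fan,
where `a` is determined by `m₋ + m₊ = a m` for consecutive rays `m₋`, `m`, `m₊`. -/
noncomputable def coneCharge (u v : Lattice) : ℂ :=
  toComplex u / toComplex v + toComplex v / toComplex u - 3

/-- The charge is additive under the subdivision of a unimodular cone by its mediant. -/
theorem coneCharge_mediant {u v : Lattice} (hu : u ≠ 0) (hv : v ≠ 0) (huv : u + v ≠ 0) :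
    coneCharge u (u + v) + coneCharge (u + v) v = coneCharge u v := by
  have h1 := toComplex_ne_zero hu
  have h2 := toComplex_ne_zero hv
  have h3 := toComplex_ne_zero huv
  simp only [coneCharge]
  rw [toComplex_add] at h3 ⊢
  field_simp
  ring

/-- If a smooth fan contains the rays of a unimodular cone and a ray inside it, then it contains the
ray of the mediant. -/
theorem IsSmoothFan.mediant_mem {S : Finset Lattice} (hS : IsSmoothFan S) {u v : Lattice}
    (hu : u ∈ S) (hv : v ∈ S) (huv : det u v = 1) {l : Lattice} (hl : l ∈ S) (hul : 0 < det u l)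
    (hlv : 0 < det l v) : u + v ∈ S := by
  have hne : u + v ≠ 0 := by
    intro h0
    have : det u (u + v) = 1 := by rw [det_add_right, det_self, huv]; rfl
    rw [h0] at this
    simp [det] at this
  obtain ⟨w, n, hwn, h0, h1⟩ := hS.exists_inCone hne
  have hd := hS.det_eq_one w n hwn
  have hcr := det_smul_eq w n (u + v)
  rw [hd, one_smul] at hcr
  set i := det (u + v) n with hi
  set j := det w (u + v) with hj
  have hprim : IsPrimitive (u + v) :=
    isPrimitive_of_det_eq_one' (m := u) (by rw [det_add_right, det_self, huv]; rfl)
  have e1 : i * det u w + j * det u n = 1 := by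
    rw [← det_smul_right, ← det_smul_right, ← det_add_right, ← hcr, det_add_right, det_self, huv]
    rfl
  have e2 : i * det w v + j * det n v = 1 := by
    rw [← det_smul_left, ← det_smul_left, ← det_add_left, ← hcr, det_add_left, det_self, huv]
    rfl
  have e3 : j = det w u + det w v := by rw [hj, det_add_right]
  have e4 : i = det u n + det v n := by rw [hi, det_add_left]
  rcases h0.eq_or_lt with hj0 | hj0
  · rw [← hj0, zero_smul, add_zero] at hcr
    rcases Int.isUnit_iff.1 (hprim.isUnit_of_eq_smul hcr) with h | h
    · rw [hcr, h, one_smul]; exact hwn.1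
    · linarith
  · -- Now the mediant lies strictly inside the cone of `w` and `n`, and `u` and `v` do not. So the
    -- cone of `w` and `n` is contained in the cone of `u` and `v`, and it has to be equal to it,
    -- but it contains no other ray of the fan.
    exfalso
    have s1 := det_swap u w
    have s2 := det_swap n v
    have s3 := det_swap n u
    have s4 := det_swap w v
    have nu := hwn.2.2.2 u hu
    have nv := hwn.2.2.2 v hv
    have a1 : 0 ≤ det u w := by
      by_contra hc
      push Not at hc
      have : det u n ≤ 0 := by by_contra hc'; exact nu ⟨by linarith, by linarith⟩
      nlinarith
    have a2 : 0 ≤ det u n := by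
      by_contra hc
      push Not at hc
      have : 0 < det u w := by by_contra hc'; push Not at hc'; nlinarith
      exact nv ⟨by linarith, by linarith⟩
    have a3 : 0 ≤ det n v := by
      by_contra hc
      push Not at hc
      have : det w v ≤ 0 := by by_contra hc'; exact nv ⟨by linarith, by linarith⟩
      nlinarith
    have a4 : 0 ≤ det w v := by
      by_contra hc
      push Not at hc
      have : 0 < det n v := by by_contra hc'; push Not at hc'; nlinarith
      exact nu ⟨by linarith, by linarith⟩
    have c1 := det_smul_eq u v w
    have c2 := det_smul_eq u v n
    rw [huv, one_smul] at c1 c2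
    rcases a1.eq_or_lt with h | h
    · rw [← h, zero_smul, add_zero] at c1
      have hw : w = u := by
        rcases Int.isUnit_iff.1 ((hS.primitive w hwn.1).isUnit_of_eq_smul c1) with h' | h'
        · rw [c1, h', one_smul]
        · linarith
      have hn1 : det u n = 1 := by rw [← hw]; exact hd
      have hwv : det w v = 1 := by rw [hw]; exact huv
      have hnv : det n v = 0 := by nlinarith
      rw [hnv, hn1, zero_smul, zero_add, one_smul] at c2
      rw [hw, c2] at hwn
      exact hwn.2.2.2 l hl ⟨hul, hlv⟩
    · have hun : det u n = 0 := by nlinarith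
      have huw : det u w = 1 := by nlinarith
      rw [hun, zero_smul, add_zero] at c2
      have : det w n = det n v * det w u := by
        conv_lhs => rw [c2]
        rw [det_smul_right]
      nlinarith

/-- A unimodular cone spanned by rays of a smooth fan has the total charge of its parts. -/
theorem IsSmoothFan.sum_coneCharge_inCone {S : Finset Lattice} (hS : IsSmoothFan S)
    {nx : Lattice → Lattice} (hnx : ∀ m ∈ S, IsNext S m (nx m)) (N : ℕ) :
    ∀ {u v : Lattice}, u ∈ S → v ∈ S → det u v = 1 →
      (S.filter fun l => 0 < det u l ∧ 0 < det l v).card ≤ N →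
      ∑ l ∈ S with InCone u v l, coneCharge l (nx l) = coneCharge u v := by
  induction N with
  | zero =>
    intro u v hu hv huv hN
    have hempty : ∀ k ∈ S, ¬(0 < det u k ∧ 0 < det k v) := by
      intro k hk
      exact Finset.filter_eq_empty_iff.1 (Finset.card_eq_zero.1 (Nat.le_zero.1 hN)) hk
    have hN' : IsNext S u v := ⟨hu, hv, by rw [huv]; exact one_pos, hempty⟩
    rw [Finset.sum_eq_single_of_mem u, hS.next_unique (hnx u hu) hN']
    · exact Finset.mem_filter.2 ⟨hu, (det_self u).ge, by rw [huv]; exact one_pos⟩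
    · intro l hl hlu
      obtain ⟨hlS, h0, h1⟩ := Finset.mem_filter.1 hl
      rcases InCone.eq_or_det_pos (hS.primitive u hu) (hS.primitive l hlS) hN'.2.2.1 ⟨h0, h1⟩
        with e | e
      · exact (hlu e).elim
      · exact (hempty l hlS ⟨e, h1⟩).elim
  | succ N ih =>
    intro u v hu hv huv hN
    rcases (S.filter fun l => 0 < det u l ∧ 0 < det l v).eq_empty_or_nonempty with he | ⟨l, hl⟩
    · exact ih hu hv huv (by rw [he]; simp)
    obtain ⟨hlS, hul, hlv⟩ := Finset.mem_filter.1 hl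
    have hm := hS.mediant_mem hu hv huv hlS hul hlv
    have d1 : det u (u + v) = 1 := by rw [det_add_right, det_self, huv]; rfl
    have d2 : det (u + v) v = 1 := by rw [det_add_left, det_self, huv]; rfl
    have hmem : u + v ∈ S.filter fun l => 0 < det u l ∧ 0 < det l v :=
      Finset.mem_filter.2 ⟨hm, by rw [d1]; exact one_pos, by rw [d2]; exact one_pos⟩
    have hcard : ∀ P : Lattice → Prop, [DecidablePred P] →
        (∀ k, P k → 0 < det u k ∧ 0 < det k v) → ¬ P (u + v) → (S.filter P).card ≤ N := by
      intro P _ h1 h2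
      have : S.filter P ⊂ S.filter fun l => 0 < det u l ∧ 0 < det l v := by
        refine (Finset.ssubset_iff_of_subset fun k hk => ?_).2 ⟨u + v, hmem, ?_⟩
        · exact Finset.mem_filter.2 ⟨(Finset.mem_filter.1 hk).1, h1 k (Finset.mem_filter.1 hk).2⟩
        · exact fun h => h2 (Finset.mem_filter.1 h).2
      have := Finset.card_lt_card this
      omega
    have r1 := ih hu hm d1 (hcard _ (fun k hk => ⟨hk.1, by
      have := hk.2; rw [det_add_right, det_swap u k] at this; linarith [hk.1]⟩) (fun h => by
        have := h.2; rw [det_self] at this; exact this.false))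
    have r2 := ih hm hv d2 (hcard _ (fun k hk => ⟨by
      have := hk.1; rw [det_add_left, det_swap k v] at this; linarith [hk.2], hk.2⟩) (fun h => by
        have := h.1; rw [det_self] at this; exact this.false))
    rw [← coneCharge_mediant (hS.primitive u hu).ne_zero (hS.primitive v hv).ne_zero
      (hS.primitive _ hm).ne_zero, ← r1, ← r2, ← Finset.sum_union]
    · refine Finset.sum_congr ?_ fun _ _ => rfl
      ext k
      simp only [Finset.mem_union, Finset.mem_filter]
      simp only [InCone, det_add_right, det_add_left]
      rw [det_swap u k, det_swap k v]
      constructor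
      · rintro ⟨hk, h1, h2⟩
        rcases le_or_gt (-det v k) (det u k) with h | h
        all_goals grind
      · grind
    · rw [Finset.disjoint_left]
      intro k hk hk'
      have h1 := (Finset.mem_filter.1 hk).2.2
      have h2 := (Finset.mem_filter.1 hk').2.1
      rw [det_swap] at h2
      linarith

/-- The total charge does not change when a smooth fan is refined. -/
theorem IsSmoothFan.sum_coneCharge_eq_of_subset {S S' : Finset Lattice} (hS : IsSmoothFan S)
    (hS' : IsSmoothFan S') (hsub : S ⊆ S') {nx nx' : Lattice → Lattice}
    (hnx : ∀ m ∈ S, IsNext S m (nx m)) (hnx' : ∀ m ∈ S', IsNext S' m (nx' m)) :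
    ∑ m ∈ S, coneCharge m (nx m) = ∑ m ∈ S', coneCharge m (nx' m) := by
  rw [← hS.sum_sum_inCone hnx S' (fun k hk => (hS'.primitive k hk).ne_zero)]
  refine Finset.sum_congr rfl fun m hm => ?_
  exact (hS'.sum_coneCharge_inCone hnx' _ (hsub hm) (hsub (hnx m hm).2.1)
    (hS.det_eq_one _ _ (hnx m hm)) le_rfl).symm

/-- The square of the Euclidean length. -/
def normSq (m : Lattice) : ℤ := m.1 ^ 2 + m.2 ^ 2

/-- The scalar product. -/
def dot (m n : Lattice) : ℤ := m.1 * n.1 + m.2 * n.2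

theorem normSq_mul_normSq (m n : Lattice) : normSq m * normSq n = dot m n ^ 2 + det m n ^ 2 := by
  simp only [normSq, dot, det]; ring

theorem finite_normSq_le (R : ℤ) : {m : Lattice | normSq m ≤ R}.Finite := by
  refine (Set.finite_Icc ((-R, -R) : Lattice) (R, R)).subset fun m hm => ?_
  have h : m.1 ^ 2 + m.2 ^ 2 ≤ R := hm
  have h1 := Int.le_self_sq m.1
  have h2 := Int.le_self_sq m.2
  have h3 := Int.le_self_sq (-m.1)
  have h4 := Int.le_self_sq (-m.2)
  simp only [even_two, Even.neg_pow] at h3 h4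
  refine ⟨⟨?_, ?_⟩, ⟨?_, ?_⟩⟩ <;> simp only <;> nlinarith [sq_nonneg m.1, sq_nonneg m.2]

theorem IsPrimitive.normSq_pos {m : Lattice} (h : IsPrimitive m) : 0 < normSq m := by
  have := h.ne_zero
  rcases lt_or_eq_of_le (by simp only [normSq]; positivity : 0 ≤ normSq m) with h | h
  · exact h
  · exfalso
    apply this
    simp only [normSq] at h
    have h1 : m.1 ^ 2 = 0 := by nlinarith [sq_nonneg m.1, sq_nonneg m.2]
    have h2 : m.2 ^ 2 = 0 := by nlinarith [sq_nonneg m.1, sq_nonneg m.2]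
    exact Prod.ext (by simpa using h1) (by simpa using h2)

/-- Among the vectors `n` with `det m n = 1` there is one whose component along `m` is nonnegative
and less than `m`. -/
theorem IsPrimitive.exists_reduced {m : Lattice} (h : IsPrimitive m) :
    ∃ n : Lattice, det m n = 1 ∧ 0 ≤ dot m n ∧ dot m n < normSq m := by
  obtain ⟨a, ha⟩ := h.exists_det_eq_one
  have hd := h.normSq_pos
  have key : ∀ c : ℤ, dot m (a + c • m) = dot m a + c * normSq m := fun c => by
    simp only [dot, normSq, Prod.fst_add, Prod.snd_add, Prod.smul_fst, Prod.smul_snd, smul_eq_mul]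
    ring
  refine ⟨a + (-(dot m a / normSq m)) • m, ?_, ?_, ?_⟩
  · rw [det_add_right, det_smul_right, det_self, ha]; ring
  · rw [key]
    have := Int.emod_nonneg (dot m a) hd.ne'
    rw [Int.emod_def] at this
    linarith
  · rw [key]
    have := Int.emod_lt_of_pos (dot m a) hd
    rw [Int.emod_def] at this
    linarith

/-- The primitive vectors in a disk. -/
noncomputable def primitiveDisk (R : ℤ) : Finset Lattice :=
  ((finite_normSq_le R).subset (Set.sep_subset _ IsPrimitive)).toFinset

theorem mem_primitiveDisk {R : ℤ} {m : Lattice} :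
    m ∈ primitiveDisk R ↔ normSq m ≤ R ∧ IsPrimitive m := by
  simp [primitiveDisk]

theorem isSmoothFan_of_exists {S : Finset Lattice} (hne : S.Nonempty)
    (hp : ∀ m ∈ S, IsPrimitive m) (h : ∀ m ∈ S, ∃ n, IsNext S m n ∧ det m n = 1) :
    IsSmoothFan S := by
  have hF : IsFan S := ⟨hne, hp, fun m hm => (h m hm).imp fun _ h => h.1⟩
  refine ⟨hF, fun m n hmn => ?_⟩
  obtain ⟨n', hn', h1⟩ := h m hmn.1
  rw [hF.next_unique hmn hn', h1]

theorem isSmoothFan_primitiveDisk {R : ℤ} (hR : 1 ≤ R) : IsSmoothFan (primitiveDisk R) := by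
  refine isSmoothFan_of_exists
    ⟨(1, 0), mem_primitiveDisk.2 ⟨by simpa [normSq] using hR, by simp [IsPrimitive]⟩⟩
    (fun m hm => (mem_primitiveDisk.1 hm).2) fun m hm => ?_
  obtain ⟨hmR, hmp⟩ := mem_primitiveDisk.1 hm
  obtain ⟨a, ha1, ha2, ha3⟩ := hmp.exists_reduced
  have hpos := hmp.normSq_pos
  have haR : a ∈ primitiveDisk R := by
    refine mem_primitiveDisk.2 ⟨?_, isPrimitive_of_det_eq_one' ha1⟩
    have := normSq_mul_normSq m a
    rw [ha1] at this
    nlinarith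
  -- Among the vectors over `m` at height one take the one that leans furthest towards `m`.
  obtain ⟨b, hb, hmax⟩ := ((primitiveDisk R).filter fun n => det m n = 1).exists_max_image
    (dot m) ⟨a, Finset.mem_filter.2 ⟨haR, ha1⟩⟩
  obtain ⟨hbR, hb1⟩ := Finset.mem_filter.1 hb
  have hb0 : 0 ≤ dot m b := ha2.trans (hmax a (Finset.mem_filter.2 ⟨haR, ha1⟩))
  refine ⟨b, ⟨hm, hbR, by rw [hb1]; exact one_pos, ?_⟩, hb1⟩
  rintro k hk ⟨hk1, hk2⟩
  have hcr := det_smul_eq m b k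
  rw [hb1, one_smul] at hcr
  have hbp := (isPrimitive_of_det_eq_one' hb1).normSq_pos
  have hkn : normSq k = det k b ^ 2 * normSq m + 2 * det k b * det m k * dot m b +
      det m k ^ 2 * normSq b := by
    conv_lhs => rw [hcr]
    simp only [normSq, dot, Prod.fst_add, Prod.snd_add, Prod.smul_fst, Prod.smul_snd, smul_eq_mul]
    ring
  have hsum : normSq (m + b) = normSq m + 2 * dot m b + normSq b := by
    simp only [normSq, dot, Prod.fst_add, Prod.snd_add]; ring
  have hle : normSq (m + b) ≤ R := by
    refine le_trans ?_ (mem_primitiveDisk.1 hk).1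
    rw [hkn, hsum]
    have t1 : 1 ≤ det k b := hk2
    have t2 : 1 ≤ det m k := hk1
    have t3 : 1 ≤ det k b * det m k := by nlinarith
    have t4 : 1 ≤ det k b ^ 2 := by nlinarith
    have t5 : 1 ≤ det m k ^ 2 := by nlinarith
    have t6 := mul_le_mul_of_nonneg_right t3 hb0
    have t7 := mul_le_mul_of_nonneg_right t4 hpos.le
    have t8 := mul_le_mul_of_nonneg_right t5 hbp.le
    linarith
  have hd : det m (m + b) = 1 := by rw [det_add_right, det_self, hb1]; rfl
  have := hmax (m + b) (Finset.mem_filter.2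
    ⟨mem_primitiveDisk.2 ⟨hle, isPrimitive_of_det_eq_one' hd⟩, hd⟩)
  have hdot : dot m (m + b) = normSq m + dot m b := by
    simp only [normSq, dot, Prod.fst_add, Prod.snd_add]; ring
  linarith

/-- The rays of the coordinate axes. -/
def axes : Finset Lattice := {(1, 0), (0, 1), (-1, 0), (0, -1)}

theorem isNext_axes : ∀ m ∈ axes, IsNext axes m (-m.2, m.1) := by
  unfold IsNext
  decide

theorem isSmoothFan_axes : IsSmoothFan axes := by
  refine isSmoothFan_of_exists (by decide) (fun m hm => ?_)
    fun m hm => ⟨_, isNext_axes m hm, ?_⟩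
  all_goals
    simp only [axes, Finset.mem_insert, Finset.mem_singleton] at hm
    rcases hm with rfl | rfl | rfl | rfl <;> simp [IsPrimitive, det]

theorem sum_coneCharge_axes : ∑ m ∈ axes, coneCharge m (-m.2, m.1) = -12 := by
  have key : ∀ m ∈ axes, coneCharge m (-m.2, m.1) = -3 := by
    intro m hm
    have h0 := toComplex_ne_zero (isSmoothFan_axes.primitive m hm).ne_zero
    have hI : toComplex (-m.2, m.1) = Complex.I * toComplex m := by
      apply Complex.ext <;> simp [toComplex]
    rw [coneCharge, hI]
    have := Complex.I_ne_zero
    field_simp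
    rw [Complex.I_sq]
    ring
  rw [Finset.sum_congr rfl key, Finset.sum_const]
  norm_num [axes]

/-- The charge of every smooth fan is `-12`: a smooth fan and the fan of the coordinate axes have
the common refinement by all primitive vectors in a large disk. -/
theorem IsSmoothFan.sum_coneCharge {S : Finset Lattice} (hS : IsSmoothFan S)
    {nx : Lattice → Lattice} (hnx : ∀ m ∈ S, IsNext S m (nx m)) :
    ∑ m ∈ S, coneCharge m (nx m) = -12 := by
  obtain ⟨R, hR⟩ := ((S ∪ axes).image normSq).exists_le
  have hR' : ∀ m ∈ S ∪ axes, normSq m ≤ R := fun m hm => hR _ (Finset.mem_image_of_mem _ hm)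
  have h1 : 1 ≤ R := by simpa [normSq] using hR' (1, 0) (by simp [axes])
  have hD := isSmoothFan_primitiveDisk h1
  obtain ⟨nx', hnx'⟩ := hD.exists_next_fun
  rw [hS.sum_coneCharge_eq_of_subset hD (fun m hm => mem_primitiveDisk.2
      ⟨hR' m (Finset.mem_union_left _ hm), hS.primitive m hm⟩) hnx hnx',
    ← isSmoothFan_axes.sum_coneCharge_eq_of_subset hD (fun m hm => mem_primitiveDisk.2
      ⟨hR' m (Finset.mem_union_right _ hm), isSmoothFan_axes.primitive m hm⟩) isNext_axes hnx',
    sum_coneCharge_axes]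

/-- For consecutive rays `m`, `n`, `l` of a smooth fan, `m + l` is a multiple of `n`. -/
theorem add_eq_smul_of_det_eq_one {m n l : Lattice} (h1 : det m n = 1) (h2 : det n l = 1) :
    m + l = det m l • n := by
  have := det_smul_eq m n l
  rw [h1, one_smul, det_swap n l, h2] at this
  rw [this, neg_one_smul]
  abel_nf
  rw [det_add_right, det_smul_right, det_smul_right, det_self, h1]
  simp

/-- The number twelve: if `m₋ + m₊ = a m` for consecutive rays `m₋`, `m`, `m₊` of a smooth fan, then
the numbers `3 - a` sum to `12` over all rays `m`. -/
theorem IsSmoothFan.sum_det_next {S : Finset Lattice} (hS : IsSmoothFan S)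
    {nx : Lattice → Lattice} (hnx : ∀ m ∈ S, IsNext S m (nx m)) :
    ∑ m ∈ S, det m (nx (nx m)) = 3 * (S.card : ℤ) - 12 := by
  have h := hS.sum_coneCharge hnx
  have key : ∀ m ∈ S, ((det m (nx (nx m)) : ℤ) : ℂ) =
      toComplex m / toComplex (nx m) + toComplex (nx (nx m)) / toComplex (nx m) := by
    intro m hm
    have hn := hnx m hm
    have hn' := hnx _ hn.2.1
    have h0 := toComplex_ne_zero (hS.primitive _ hn.2.1).ne_zero
    have e := congrArg toComplex
      (add_eq_smul_of_det_eq_one (hS.det_eq_one _ _ hn) (hS.det_eq_one _ _ hn'))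
    rw [toComplex_add, toComplex_smul] at e
    field_simp
    linear_combination -e
  have h2 : ((∑ m ∈ S, det m (nx (nx m)) : ℤ) : ℂ) = 3 * (S.card : ℂ) - 12 := by
    push_cast
    rw [Finset.sum_congr rfl key, Finset.sum_add_distrib,
      hS.sum_next hnx fun n => toComplex (nx n) / toComplex n]
    simp only [coneCharge, Finset.sum_sub_distrib, Finset.sum_add_distrib, Finset.sum_const,
      nsmul_eq_mul] at h
    linear_combination h
  exact_mod_cast h2

/-! ### Wave fronts and tight covectors -/

/-- The minimum of the covector `m` on the compact set `Φ`. -/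
noncomputable def minValue (Φ : Set Plane) (m : Lattice) : ℝ := sInf (pairing m '' Φ)

/-- Compact convex sets with nonempty interior. -/
structure IsBody (Φ : Set Plane) : Prop where
  convex : Convex ℝ Φ
  compact : IsCompact Φ
  interior_nonempty : (interior Φ).Nonempty

/-- The covectors that are tight at time `t`: those that the wave front has followed at unit
speed. -/
def tightSet (Φ : Set Plane) (t : ℝ) : Set Lattice :=
  {m | IsPrimitive m ∧ ∃ p ∈ propagation Φ t, pairing m p = minValue Φ m + t}

theorem propagation_antitone (Φ : Set Plane) {s t : ℝ} (h : s ≤ t) :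
    propagation Φ t ⊆ propagation Φ s :=
  fun _ hp m c hc => by linarith [hp m c hc]

theorem isClosed_propagation (Φ : Set Plane) (t : ℝ) : IsClosed (propagation Φ t) := by
  have : propagation Φ t =
      ⋂ (m : Lattice) (c : ℝ) (_ : IsSupportHalfPlane Φ m c), {p | c + t ≤ pairing m p} := by
    ext p; simp [propagation]
  rw [this]
  exact isClosed_iInter fun m => isClosed_iInter fun c => isClosed_iInter fun _ =>
    isClosed_le continuous_const (continuous_pairing m)

theorem convex_propagation (Φ : Set Plane) (t : ℝ) : Convex ℝ (propagation Φ t) := by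
  intro p hp q hq a b ha hb hab m c hc
  rw [pairing_add_right, pairing_smul_right, pairing_smul_right]
  have h1 := mul_le_mul_of_nonneg_left (hp m c hc) ha
  have h2 := mul_le_mul_of_nonneg_left (hq m c hc) hb
  have : c + t = a * (c + t) + b * (c + t) := by rw [← add_mul, hab, one_mul]
  linarith

/-- The center of a ball in the wave front is reached by the wave front only later, at least by the
radius of the ball. -/
theorem mem_propagation_add {Φ : Set Plane} {t r : ℝ} (hr : 0 ≤ r) {x : Plane}
    (h : Metric.closedBall x r ⊆ propagation Φ t) : x ∈ propagation Φ (t + r) := by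
  intro m c hc
  have hy : (x.1 - r * (SignType.sign m.1 : ℤ), x.2 - r * (SignType.sign m.2 : ℤ)) ∈
      Metric.closedBall x r := by
    have hs : ∀ a : ℤ, |r * ((SignType.sign a : ℤ) : ℝ)| ≤ r := fun a => by
      rw [abs_mul, abs_of_nonneg hr]
      rcases lt_trichotomy a 0 with h | h | h <;> simp [h, hr]
    rw [Metric.mem_closedBall, dist_eq_norm, Prod.norm_def]
    refine max_le ?_ ?_
    · have := hs m.1
      simpa [Real.norm_eq_abs] using this
    · have := hs m.2
      simpa [Real.norm_eq_abs] using this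
  have h1 := h hy m c hc
  have hs : ∀ a : ℤ, (a : ℝ) * ((SignType.sign a : ℤ) : ℝ) = |(a : ℝ)| := fun a => by
    rcases lt_trichotomy a 0 with h | h | h
    · have : (a : ℝ) < 0 := by exact_mod_cast h
      simp [h, abs_of_neg this]
    · simp [h]
    · have : 0 < (a : ℝ) := by exact_mod_cast h
      simp [h, abs_of_pos this]
  have h2 : (1 : ℝ) ≤ |(m.1 : ℝ)| + |(m.2 : ℝ)| := by
    have h3 : 1 ≤ |m.1| + |m.2| := by
      by_contra hcon
      have e1 := abs_nonneg m.1
      have e2 := abs_nonneg m.2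
      have f1 : |m.1| = 0 := by omega
      have f2 : |m.2| = 0 := by omega
      exact hc.1.ne_zero (Prod.ext (abs_eq_zero.1 f1) (abs_eq_zero.1 f2))
    exact_mod_cast h3
  have h4 : pairing m (x.1 - r * (SignType.sign m.1 : ℤ), x.2 - r * (SignType.sign m.2 : ℤ)) =
      pairing m x - r * (|(m.1 : ℝ)| + |(m.2 : ℝ)|) := by
    rw [← hs, ← hs]; simp only [pairing]; ring
  rw [h4] at h1
  nlinarith

/-- While the wave front has interior points, it keeps them for some more time. -/
theorem exists_interior_propagation_add {Φ : Set Plane} {t : ℝ}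
    (h : (interior (propagation Φ t)).Nonempty) :
    ∃ r > 0, (interior (propagation Φ (t + r))).Nonempty := by
  obtain ⟨x, hx⟩ := h
  obtain ⟨r, hr, hball⟩ := Metric.isOpen_iff.1 isOpen_interior x hx
  refine ⟨r / 2, half_pos hr, x, ?_⟩
  refine interior_maximal (s := propagation Φ (t + r / 2)) (t := Metric.ball x (r / 2)) ?_
    Metric.isOpen_ball (Metric.mem_ball_self (half_pos hr))
  intro y hy
  refine mem_propagation_add (half_pos hr).le ?_
  intro z hz
  refine interior_subset (hball ?_)
  rw [Metric.mem_ball] at hy ⊢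
  rw [Metric.mem_closedBall] at hz
  linarith [dist_triangle z y x]

theorem interior_propagation_nonempty {Φ : Set Plane} {t : ℝ} (h0 : 0 ≤ t) (ht : t < finalTime Φ) :
    (interior (propagation Φ t)).Nonempty := by
  rw [Set.nonempty_iff_ne_empty]
  exact fun he => notMem_of_lt_csInf ht ⟨0, fun _ h => h.1⟩ ⟨h0, he⟩

namespace IsBody

variable {Φ : Set Plane}

theorem nonempty (hΦ : IsBody Φ) : Φ.Nonempty := hΦ.interior_nonempty.mono interior_subset

theorem exists_eq_minValue (hΦ : IsBody Φ) (m : Lattice) : ∃ q ∈ Φ, pairing m q = minValue Φ m :=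
  (hΦ.compact.image (continuous_pairing m)).sInf_mem (hΦ.nonempty.image _)

theorem minValue_le (hΦ : IsBody Φ) (m : Lattice) {p : Plane} (hp : p ∈ Φ) :
    minValue Φ m ≤ pairing m p :=
  csInf_le (hΦ.compact.image (continuous_pairing m)).bddBelow (Set.mem_image_of_mem _ hp)

theorem isSupportHalfPlane_iff (hΦ : IsBody Φ) {m : Lattice} {c : ℝ} :
    IsSupportHalfPlane Φ m c ↔ IsPrimitive m ∧ c = minValue Φ m := by
  constructor
  · rintro ⟨hm, h, p, hp, hpc⟩
    obtain ⟨q, hq, hqm⟩ := hΦ.exists_eq_minValue m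
    exact ⟨hm, le_antisymm (by rw [← hqm]; exact h q hq)
      (by rw [← hpc]; exact hΦ.minValue_le m hp)⟩
  · rintro ⟨hm, rfl⟩
    exact ⟨hm, fun p hp => hΦ.minValue_le m hp, hΦ.exists_eq_minValue m⟩

theorem mem_propagation_iff (hΦ : IsBody Φ) {t : ℝ} {p : Plane} :
    p ∈ propagation Φ t ↔ ∀ m, IsPrimitive m → minValue Φ m + t ≤ pairing m p := by
  constructor
  · exact fun h m hm => h m _ (hΦ.isSupportHalfPlane_iff.2 ⟨hm, rfl⟩)
  · intro h m c hc
    obtain ⟨hm, rfl⟩ := hΦ.isSupportHalfPlane_iff.1 hc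
    exact h m hm

/-- The minimum is a superadditive function of the covector. -/
theorem add_le_mul_minValue (hΦ : IsBody Φ) {m n k : Lattice} {a b d : ℤ} (ha : 0 ≤ a)
    (hb : 0 ≤ b) (h : d • k = a • m + b • n) :
    a * minValue Φ m + b * minValue Φ n ≤ d * minValue Φ k := by
  obtain ⟨q, hq, hqm⟩ := hΦ.exists_eq_minValue k
  have := congrArg (fun l => pairing l q) h
  simp only [pairing_add_left, pairing_smul_left] at this
  rw [← hqm, this]
  have h1 : (0 : ℝ) ≤ a := by exact_mod_cast ha
  have h2 : (0 : ℝ) ≤ b := by exact_mod_cast hb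
  exact add_le_add (mul_le_mul_of_nonneg_left (hΦ.minValue_le m hq) h1)
    (mul_le_mul_of_nonneg_left (hΦ.minValue_le n hq) h2)

/-- If `m` and `n` are tight at a common point `v`, then every combination `k` of `m` and `n` has at
`v` at most the value given by its height over the segment from `m` to `n`. -/
theorem mul_pairing_le_of_tight (hΦ : IsBody Φ) {t : ℝ} {m n k : Lattice} {v : Plane}
    (hm : pairing m v = minValue Φ m + t) (hn : pairing n v = minValue Φ n + t)
    {a b d : ℤ} (ha : 0 ≤ a) (hb : 0 ≤ b) (h : d • k = a • m + b • n) :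
    d * pairing k v ≤ d * minValue Φ k + (a + b) * t := by
  have h1 := hΦ.add_le_mul_minValue ha hb h
  have h2 := congrArg (fun l => pairing l v) h
  simp only [pairing_add_left, pairing_smul_left] at h2
  rw [h2, hm, hn]
  linarith

/-- A lattice point of the cone of `m` and `n` that is not above the segment from `m` to `n` is
tight where `m` and `n` are. -/
theorem tight_of_tight (hΦ : IsBody Φ) {t : ℝ} (ht : 0 ≤ t) {m n k : Lattice} {v : Plane}
    (hv : v ∈ propagation Φ t) (hk : IsPrimitive k)
    (hm : pairing m v = minValue Φ m + t) (hn : pairing n v = minValue Φ n + t)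
    {a b d : ℤ} (ha : 0 ≤ a) (hb : 0 ≤ b) (hd : 0 < d) (hab : a + b ≤ d)
    (h : d • k = a • m + b • n) : pairing k v = minValue Φ k + t := by
  refine le_antisymm ?_ (hΦ.mem_propagation_iff.1 hv k hk)
  have h1 := hΦ.mul_pairing_le_of_tight hm hn ha hb h
  have h2 : (a : ℝ) + b ≤ d := by exact_mod_cast hab
  have h3 : (0 : ℝ) < d := by exact_mod_cast hd
  have h4 : d * pairing k v ≤ d * (minValue Φ k + t) := by
    nlinarith [mul_le_mul_of_nonneg_right h2 ht]
  exact le_of_mul_le_mul_left h4 h3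

/-- No lattice point of the cone of `m` and `n` lies below the segment from `m` to `n` if `m` and
`n` are tight at a common point. -/
theorem le_add_of_tight (hΦ : IsBody Φ) {t : ℝ} (ht : 0 < t) {m n k : Lattice} {v : Plane}
    (hv : v ∈ propagation Φ t) (hk : IsPrimitive k)
    (hm : pairing m v = minValue Φ m + t) (hn : pairing n v = minValue Φ n + t)
    {a b d : ℤ} (ha : 0 ≤ a) (hb : 0 ≤ b) (hd : 0 < d)
    (h : d • k = a • m + b • n) : d ≤ a + b := by
  have h1 := hΦ.mul_pairing_le_of_tight hm hn ha hb h
  have h2 := hΦ.mem_propagation_iff.1 hv k hk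
  have h3 : (0 : ℝ) < d := by exact_mod_cast hd
  have h4 : (d : ℝ) * t ≤ (a + b) * t := by nlinarith [mul_le_mul_of_nonneg_left h2 h3.le]
  have h5 : (d : ℝ) ≤ a + b := le_of_mul_le_mul_right h4 ht
  exact_mod_cast h5

/-- Every long primitive covector is a sum of two shorter ones, for which superadditivity of the
minimum is almost an equality. So long covectors impose no condition on the wave front at time
`t`. -/
theorem exists_add_eq_of_normSq_large (hΦ : IsBody Φ) {t : ℝ} (ht : 0 < t) :
    ∃ R : ℤ, ∀ l, IsPrimitive l → R < normSq l → ∃ m n, IsPrimitive m ∧ IsPrimitive n ∧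
      l = m + n ∧ normSq m < normSq l ∧ normSq n < normSq l ∧
      minValue Φ l < minValue Φ m + minValue Φ n + t := by
  obtain ⟨D, hD⟩ := Metric.isBounded_iff.1 hΦ.compact.isBounded
  obtain ⟨K, hK⟩ := exists_nat_gt (2 * D / t)
  have hKt : 2 * D < K * t := by rwa [div_lt_iff₀ ht] at hK
  refine ⟨2 * K ^ 2 + 1, fun l hl hR => ?_⟩
  obtain ⟨m, hm1, hm2, hm3⟩ := hl.exists_reduced
  have hpos := hl.normSq_pos
  have hdet : det l (l - m) = -1 := by
    rw [sub_eq_add_neg, det_add_right, det_self]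
    simp only [det, Prod.fst_neg, Prod.snd_neg] at hm1 ⊢
    linarith
  have hmp := isPrimitive_of_det_eq_one' hm1
  have hnp : IsPrimitive (l - m) := isPrimitive_of_det_eq_one (n := l) (by
    rw [det_swap, hdet]; rfl)
  have hml := normSq_mul_normSq l m
  have hnl := normSq_mul_normSq l (l - m)
  have hdot : dot l (l - m) = normSq l - dot l m := by
    simp only [dot, normSq, Prod.fst_sub, Prod.snd_sub]; ring
  rw [hm1] at hml
  rw [hdet, hdot] at hnl
  have hbig : 1 < normSq l := by nlinarith [sq_nonneg (K : ℤ)]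
  have hdot1 : 1 ≤ dot l m := by
    by_contra hcon
    have h0 : dot l m = 0 := by omega
    rw [h0] at hml
    have := hmp.normSq_pos
    nlinarith
  refine ⟨m, l - m, hmp, hnp, by abel, by nlinarith, by nlinarith, ?_⟩
  obtain ⟨q, hq, hql⟩ := hΦ.exists_eq_minValue l
  have hD0 : 0 ≤ D := dist_nonneg.trans (hD hq hq)
  set M : ℝ := |(l.1 : ℝ)| + |(l.2 : ℝ)| with hM
  have hsq : (normSq l : ℝ) = |(l.1 : ℝ)| ^ 2 + |(l.2 : ℝ)| ^ 2 := by
    rw [sq_abs, sq_abs]; simp [normSq]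
  have hdiff : ∀ {q'}, q' ∈ Φ →
      |(l.1 : ℝ) * (q'.2 - q.2) - l.2 * (q'.1 - q.1)| ≤ M * D := by
    intro q' hq'
    have h1 : dist q' q ≤ D := hD hq' hq
    rw [Prod.dist_eq, max_le_iff, Real.dist_eq, Real.dist_eq] at h1
    calc |(l.1 : ℝ) * (q'.2 - q.2) - l.2 * (q'.1 - q.1)|
        ≤ |(l.1 : ℝ) * (q'.2 - q.2)| + |(l.2 : ℝ) * (q'.1 - q.1)| := abs_sub _ _
      _ = |(l.1 : ℝ)| * |q'.2 - q.2| + |(l.2 : ℝ)| * |q'.1 - q.1| := by rw [abs_mul, abs_mul]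
      _ ≤ |(l.1 : ℝ)| * D + |(l.2 : ℝ)| * D := by
          gcongr
          · exact h1.2
          · exact h1.1
      _ = M * D := by rw [hM]; ring
  -- A part of `l` has nonnegative component along `l`, so its minimum is controlled by the
  -- component perpendicular to `l`.
  have hpart : ∀ {k : Lattice} {e : ℤ}, 0 ≤ dot l k → det l k = e → |(e : ℝ)| = 1 →
      normSq l * pairing k q - M * D ≤ normSq l * minValue Φ k := by
    intro k e hk1 hk2 he
    obtain ⟨q', hq', hqk⟩ := hΦ.exists_eq_minValue k
    have h1 : 0 ≤ pairing l q' - pairing l q := by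
      rw [hql]; linarith [hΦ.minValue_le l hq']
    have h2 : (0 : ℝ) ≤ dot l k := by exact_mod_cast hk1
    have h3 : (normSq l : ℝ) * (pairing k q' - pairing k q) =
        dot l k * (pairing l q' - pairing l q) +
          det l k * ((l.1 : ℝ) * (q'.2 - q.2) - l.2 * (q'.1 - q.1)) := by
      simp only [normSq, pairing, dot, det]; push_cast; ring
    have h4 : -(M * D) ≤ det l k * ((l.1 : ℝ) * (q'.2 - q.2) - l.2 * (q'.1 - q.1)) := by
      refine (abs_le.1 ?_).1
      rw [abs_mul, hk2, he, one_mul]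
      exact hdiff hq'
    rw [← hqk]
    nlinarith [mul_nonneg h2 h1]
  have p1 := hpart hm2 hm1 (by simp)
  have p2 := hpart (k := l - m) (by rw [hdot]; linarith) hdet (by simp)
  have hsplit : pairing (l - m) q = pairing l q - pairing m q := by
    simp only [pairing, Prod.fst_sub, Prod.snd_sub]; push_cast; ring
  rw [hsplit] at p2
  have hN : (0 : ℝ) < normSq l := by exact_mod_cast hpos
  have hR' : (2 : ℝ) * K ^ 2 < normSq l := by
    have h1 : (2 * K ^ 2 : ℤ) < normSq l := by linarith
    exact_mod_cast h1
  have hMs : M ^ 2 ≤ 2 * normSq l := by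
    rw [hsq, hM]; nlinarith [sq_nonneg (|(l.1 : ℝ)| - |(l.2 : ℝ)|)]
  have hM0 : 0 ≤ M := by positivity
  have hMK : M * K < normSq l := by
    by_contra hcon
    push Not at hcon
    have h1 : (normSq l : ℝ) * normSq l ≤ (M * K) * (M * K) :=
      mul_self_le_mul_self hN.le hcon
    have hK0 : (0 : ℝ) ≤ (K : ℝ) ^ 2 := by positivity
    nlinarith [mul_le_mul_of_nonneg_right hMs hK0]
  have hMl : 2 * (M * D) < normSq l * t ∨ M = 0 := by
    rcases hM0.eq_or_lt with h | h
    · exact Or.inr h.symm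
    · left
      nlinarith [mul_lt_mul_of_pos_left hKt h, mul_lt_mul_of_pos_right hMK ht]
  have hfin : 2 * (M * D) < normSq l * t := by
    rcases hMl with h | h
    · exact h
    · rw [h]; simpa using mul_pos hN ht
  rw [hql] at p2
  have : (normSq l : ℝ) * minValue Φ l <
      normSq l * (minValue Φ m + minValue Φ (l - m) + t) := by nlinarith
  exact lt_of_mul_lt_mul_left this hN.le

/-- At a positive time only finitely many covectors matter for the wave front. -/
theorem exists_normSq_bound (hΦ : IsBody Φ) {t : ℝ} (ht : 0 < t) :
    ∃ R : ℤ, (∀ p, (∀ m, IsPrimitive m → normSq m ≤ R → minValue Φ m + t ≤ pairing m p) →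
        p ∈ propagation Φ t) ∧ ∀ m ∈ tightSet Φ t, normSq m ≤ R := by
  obtain ⟨R, hR⟩ := hΦ.exists_add_eq_of_normSq_large ht
  refine ⟨R, fun p hp => hΦ.mem_propagation_iff.2 ?_, ?_⟩
  · have key : ∀ (N : ℕ) (l : Lattice), IsPrimitive l → normSq l ≤ N →
        minValue Φ l + t ≤ pairing l p := by
      intro N
      induction N with
      | zero => intro l hl hN; have := hl.normSq_pos; push_cast at hN; omega
      | succ N ih =>
        intro l hl hN
        by_cases hlR : normSq l ≤ R
        · exact hp l hl hlR
        · obtain ⟨m, n, hm, hn, rfl, hml, hnl, hlt⟩ := hR l hl (not_le.1 hlR)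
          have h1 := ih m hm (by push_cast at hN; omega)
          have h2 := ih n hn (by push_cast at hN; omega)
          rw [pairing_add_left]
          linarith
    exact fun m hm => key (normSq m).toNat m hm (Int.self_le_toNat _)
  · rintro l ⟨hl, p, hp, hlp⟩
    by_contra hcon
    obtain ⟨m, n, hm, hn, e, -, -, hlt⟩ := hR l hl (not_le.1 hcon)
    have h1 := hΦ.mem_propagation_iff.1 hp m hm
    have h2 := hΦ.mem_propagation_iff.1 hp n hn
    have h3 : pairing l p = pairing m p + pairing n p := by rw [e, pairing_add_left]
    linarith

theorem finite_tightSet (hΦ : IsBody Φ) {t : ℝ} (ht : 0 < t) : (tightSet Φ t).Finite := by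
  obtain ⟨R, -, hR⟩ := hΦ.exists_normSq_bound ht
  exact (finite_normSq_le R).subset hR

/-- The directions in which one can move from a point of the wave front are given by the covectors
that are tight at this point. -/
theorem exists_add_smul_mem (hΦ : IsBody Φ) {t : ℝ} (ht : 0 < t) {v : Plane}
    (hv : v ∈ propagation Φ t) (w : Plane)
    (hw : ∀ k, IsPrimitive k → pairing k v = minValue Φ k + t → 0 ≤ pairing k w) :
    ∃ ε : ℝ, 0 < ε ∧ v + ε • w ∈ propagation Φ t := by
  obtain ⟨R, hR, -⟩ := hΦ.exists_normSq_bound ht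
  have hev : ∀ᶠ ε : ℝ in 𝓝[>] 0, ∀ k ∈ primitiveDisk R,
      minValue Φ k + t ≤ pairing k (v + ε • w) := by
    rw [Filter.eventually_all_finset]
    intro k hk
    have hkp := (mem_primitiveDisk.1 hk).2
    rcases (hΦ.mem_propagation_iff.1 hv k hkp).eq_or_lt with h | h
    · filter_upwards [self_mem_nhdsWithin] with ε hε
      rw [pairing_add_right, pairing_smul_right, h]
      have := mul_nonneg (le_of_lt hε) (hw k hkp h.symm)
      linarith
    · have hc : Continuous fun ε : ℝ => pairing k (v + ε • w) :=
        (continuous_pairing k).comp (by fun_prop)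
      have h0 : minValue Φ k + t < pairing k (v + (0 : ℝ) • w) := by simpa using h
      have := (hc.tendsto 0).eventually_const_lt h0
      exact (this.filter_mono nhdsWithin_le_nhds).mono fun _ h => h.le
  obtain ⟨ε, hε, hε0⟩ := (hev.and self_mem_nhdsWithin).exists
  exact ⟨ε, hε0, hR _ fun m hm hmR => hε m (mem_primitiveDisk.2 ⟨hmR, hm⟩)⟩

theorem isCompact_propagation (hΦ : IsBody Φ) (t : ℝ) : IsCompact (propagation Φ t) := by
  refine Metric.isCompact_of_isClosed_isBounded (isClosed_propagation Φ t) ?_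
  refine (Metric.isBounded_Icc
    ((minValue Φ (1, 0) + t, minValue Φ (0, 1) + t) : Plane)
    (-(minValue Φ (-1, 0) + t), -(minValue Φ (0, -1) + t))).subset fun p hp => ?_
  rw [hΦ.mem_propagation_iff] at hp
  have h1 := hp (1, 0) (by simp [IsPrimitive])
  have h2 := hp (0, 1) (by simp [IsPrimitive])
  have h3 := hp (-1, 0) (by simp [IsPrimitive])
  have h4 := hp (0, -1) (by simp [IsPrimitive])
  simp only [pairing] at h1 h2 h3 h4
  push_cast at h1 h2 h3 h4
  refine ⟨⟨?_, ?_⟩, ⟨?_, ?_⟩⟩ <;> simp only <;> linarith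

theorem subset_propagation_zero (Φ : Set Plane) : Φ ⊆ propagation Φ 0 :=
  fun p hp m c hc => by simpa using hc.2.1 p hp

theorem exists_interior_eq_empty (hΦ : IsBody Φ) :
    ∃ t : ℝ, 0 ≤ t ∧ interior (propagation Φ t) = ∅ := by
  obtain ⟨q, hq⟩ := hΦ.nonempty
  refine ⟨|minValue Φ (1, 0)| + |minValue Φ (-1, 0)| + 1, by positivity, ?_⟩
  rw [Set.eq_empty_iff_forall_notMem]
  intro p hp
  have h := hΦ.mem_propagation_iff.1 (interior_subset hp)
  have h1 := h (1, 0) (by simp [IsPrimitive])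
  have h3 := h (-1, 0) (by simp [IsPrimitive])
  simp only [pairing] at h1 h3
  push_cast at h1 h3
  linarith [neg_abs_le (minValue Φ (1, 0)), neg_abs_le (minValue Φ (-1, 0)),
    abs_nonneg (minValue Φ (1, 0)), abs_nonneg (minValue Φ (-1, 0))]

theorem interior_propagation_eq_empty (hΦ : IsBody Φ) {t : ℝ} (ht : finalTime Φ < t) :
    interior (propagation Φ t) = ∅ := by
  obtain ⟨s, hs, hst⟩ := exists_lt_of_csInf_lt hΦ.exists_interior_eq_empty ht
  exact Set.subset_eq_empty (interior_mono (propagation_antitone Φ hst.le)) hs.2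

theorem interior_finalLocus (hΦ : IsBody Φ) : interior (finalLocus Φ) = ∅ := by
  by_contra hne
  obtain ⟨r, hr, h⟩ := exists_interior_propagation_add (Set.nonempty_iff_ne_empty.2 hne)
  rw [hΦ.interior_propagation_eq_empty (lt_add_of_pos_right _ hr)] at h
  exact Set.not_nonempty_empty h

theorem finalTime_pos (hΦ : IsBody Φ) : 0 < finalTime Φ := by
  obtain ⟨r, hr, h⟩ := exists_interior_propagation_add (Φ := Φ) (t := 0)
    (hΦ.interior_nonempty.mono (interior_mono (subset_propagation_zero Φ)))
  by_contra hcon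
  have := hΦ.interior_propagation_eq_empty (t := 0 + r) (by linarith)
  rw [this] at h
  exact Set.not_nonempty_empty h

theorem isBody_propagation (hΦ : IsBody Φ) {t : ℝ} (h0 : 0 ≤ t) (ht : t < finalTime Φ) :
    IsBody (propagation Φ t) :=
  ⟨convex_propagation Φ t, hΦ.isCompact_propagation t, interior_propagation_nonempty h0 ht⟩

end IsBody

/-! ### The fans of a wave front -/

/-- If `v` minimizes `m` and `n` on `P`, then it is the only minimum of a covector strictly between
them. -/
theorem face_eq_singleton {P : Set Plane} {m n k : Lattice} {v : Plane} (hm : v ∈ face P m)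
    (hn : v ∈ face P n) (hmn : 0 < det m n) (hmk : 0 < det m k) (hkn : 0 < det k n) :
    face P k = {v} := by
  have h0 : (0 : ℝ) < det m n := by exact_mod_cast hmn
  have h1 : (0 : ℝ) < det m k := by exact_mod_cast hmk
  have h2 : (0 : ℝ) < det k n := by exact_mod_cast hkn
  have hle : ∀ q ∈ P, pairing k v ≤ pairing k q := fun q hq => by
    have e1 := det_mul_pairing m n k v
    have e2 := det_mul_pairing m n k q
    refine le_of_mul_le_mul_left ?_ h0
    rw [e1, e2]
    exact add_le_add (mul_le_mul_of_nonneg_left (hm.2 q hq) h2.le)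
      (mul_le_mul_of_nonneg_left (hn.2 q hq) h1.le)
  refine Set.eq_singleton_iff_unique_mem.2 ⟨⟨hm.1, hle⟩, fun q hq => ?_⟩
  have e1 := det_mul_pairing m n k v
  have e2 := det_mul_pairing m n k q
  have e3 : pairing k q = pairing k v := le_antisymm (hq.2 v hm.1) (hle q hq.1)
  rw [e3, e1] at e2
  have i1 := hm.2 q hq.1
  have i2 := hn.2 q hq.1
  exact eq_of_pairing_eq hmn.ne' (by nlinarith) (by nlinarith)

theorem subsingleton_face_of_between {P : Set Plane} {m n k : Lattice} {v : Plane}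
    (hm : v ∈ face P m) (hn : v ∈ face P n) (hmn : 0 < det m n) (hmk : 0 < det m k)
    (hkn : 0 < det k n) : ¬ (face P k).Nontrivial := by
  rw [face_eq_singleton hm hn hmn hmk hkn]
  exact Set.not_nontrivial_singleton

open Classical in
/-- The tight covectors at a time `t` as a finite set (if there are finitely many, so for `0 <
t`). -/
noncomputable def tights (Φ : Set Plane) (t : ℝ) : Finset Lattice :=
  if h : (tightSet Φ t).Finite then h.toFinset else ∅

open Classical in
/-- The conormals of the sides of the wave front at a time `t` as a finite set (if there are
finitely many, so for `0 < t < t_Φ`). -/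
noncomputable def sides (Φ : Set Plane) (t : ℝ) : Finset Lattice :=
  if h : {m | IsSide (propagation Φ t) m}.Finite then h.toFinset else ∅

namespace IsBody

variable {Φ : Set Plane}

theorem mem_tights (hΦ : IsBody Φ) {t : ℝ} (ht : 0 < t) {m : Lattice} :
    m ∈ tights Φ t ↔ m ∈ tightSet Φ t := by
  rw [tights, dif_pos (hΦ.finite_tightSet ht)]
  simp

theorem mem_face_iff (hΦ : IsBody Φ) {t : ℝ} {m : Lattice} (hm : m ∈ tightSet Φ t) {q : Plane} :
    q ∈ face (propagation Φ t) m ↔ q ∈ propagation Φ t ∧ pairing m q = minValue Φ m + t := by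
  obtain ⟨hmp, p, hp, hpm⟩ := hm
  constructor
  · exact fun h => ⟨h.1, le_antisymm (hpm ▸ h.2 p hp) (hΦ.mem_propagation_iff.1 h.1 m hmp)⟩
  · exact fun h => ⟨h.1, fun r hr => by
      rw [h.2]; exact hΦ.mem_propagation_iff.1 hr m hmp⟩

theorem mem_face_of_tight (hΦ : IsBody Φ) {t : ℝ} {m : Lattice} (hmp : IsPrimitive m) {v : Plane}
    (hv : v ∈ propagation Φ t) (hm : pairing m v = minValue Φ m + t) :
    v ∈ face (propagation Φ t) m :=
  (hΦ.mem_face_iff ⟨hmp, v, hv, hm⟩).2 ⟨hv, hm⟩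

theorem exists_pairing_gt (hΦ : IsBody Φ) {t : ℝ} (h0 : 0 ≤ t) (ht : t < finalTime Φ) :
    ∃ x, ∀ k, IsPrimitive k → minValue Φ k + t < pairing k x := by
  obtain ⟨r, hr, x, hx⟩ := exists_interior_propagation_add (interior_propagation_nonempty h0 ht)
  refine ⟨x, fun k hk => ?_⟩
  have := hΦ.mem_propagation_iff.1 (interior_subset hx) k hk
  linarith

/-- The sides of a wave front are tight. -/
theorem mem_tightSet_of_isSide (hΦ : IsBody Φ) {t : ℝ} (ht : 0 < t) {m : Lattice}
    (hm : IsSide (propagation Φ t) m) : m ∈ tightSet Φ t := by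
  obtain ⟨hmp, p, hp, q, hq, hpq⟩ := hm
  by_contra hcon
  have hmpq : pairing m p = pairing m q := le_antisymm (hp.2 q hq.1) (hq.2 p hp.1)
  -- At the midpoint of two points of the side, only `m` and `-m` can be tight.
  set z : Plane := (1 / 2 : ℝ) • p + (1 / 2 : ℝ) • q with hz
  have hzP : z ∈ propagation Φ t :=
    convex_propagation Φ t hp.1 hq.1 (by norm_num) (by norm_num) (by norm_num)
  have hzv : ∀ k : Lattice, pairing k z = (pairing k p + pairing k q) / 2 := fun k => by
    rw [hz, pairing_add_right, pairing_smul_right, pairing_smul_right]; ring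
  have hsq : 0 < pairing m (toPlane m) := by
    have h1 : (0 : ℝ) < normSq m := by exact_mod_cast hmp.normSq_pos
    have h2 : pairing m (toPlane m) = normSq m := by
      simp only [pairing, toPlane, normSq]; push_cast; ring
    rwa [h2]
  obtain ⟨ε, hε, hmem⟩ := hΦ.exists_add_smul_mem ht hzP (-toPlane m) (fun k hk hkz => by
    have h1 := hΦ.mem_propagation_iff.1 hp.1 k hk
    have h2 := hΦ.mem_propagation_iff.1 hq.1 k hk
    rw [hzv] at hkz
    have hd : det m k = 0 := by
      by_contra hd
      exact hpq (eq_of_pairing_eq hd hmpq (by linarith))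
    rcases eq_or_eq_neg_of_det_eq_zero hmp hk hd with rfl | rfl
    · exact (hcon ⟨hk, z, hzP, by rw [hzv]; exact hkz⟩).elim
    · rw [pairing_neg_left, pairing_neg_right]; linarith)
  have := hp.2 _ hmem
  rw [pairing_add_right, pairing_smul_right, pairing_neg_right, hzv, ← hmpq] at this
  nlinarith

theorem mem_sides (hΦ : IsBody Φ) {t : ℝ} (ht : 0 < t) {m : Lattice} :
    m ∈ sides Φ t ↔ IsSide (propagation Φ t) m := by
  have hfin : {m | IsSide (propagation Φ t) m}.Finite :=
    (hΦ.finite_tightSet ht).subset fun m hm => hΦ.mem_tightSet_of_isSide ht hm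
  rw [sides, dif_pos hfin]
  simp

theorem sides_subset_tights (hΦ : IsBody Φ) {t : ℝ} (ht : 0 < t) : sides Φ t ⊆ tights Φ t :=
  fun _ hm => (hΦ.mem_tights ht).2 (hΦ.mem_tightSet_of_isSide ht ((hΦ.mem_sides ht).1 hm))

/-- The face of a tight covector has a last point in counterclockwise order. There another covector
is tight, which comes later in counterclockwise order. -/
theorem exists_tight_det_pos (hΦ : IsBody Φ) {t : ℝ} (ht : 0 < t) {m : Lattice}
    (hm : m ∈ tightSet Φ t) : ∃ v ∈ propagation Φ t, pairing m v = minValue Φ m + t ∧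
      ∃ k, IsPrimitive k ∧ pairing k v = minValue Φ k + t ∧ 0 < det m k := by
  obtain ⟨hmp, p, hp, hpm⟩ := hm
  have hcomp : IsCompact {q | q ∈ propagation Φ t ∧ pairing m q = minValue Φ m + t} :=
    (hΦ.isCompact_propagation t).inter_right
      (isClosed_eq (continuous_pairing m) continuous_const)
  obtain ⟨v, ⟨hv, hvm⟩, hmax⟩ := hcomp.exists_isMaxOn ⟨p, hp, hpm⟩
    (continuous_pairing (turn m)).continuousOn
  refine ⟨v, hv, hvm, ?_⟩
  by_contra hcon
  push Not at hcon
  obtain ⟨ε, hε, hmem⟩ := hΦ.exists_add_smul_mem ht hv (toPlane (turn m)) (fun k hk hkv => by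
    rw [pairing_turn]
    have : (det m k : ℝ) ≤ 0 := by exact_mod_cast hcon k hk hkv
    linarith)
  have h1 := hmax (a := v + ε • toPlane (turn m)) ⟨hmem, by
    rw [pairing_add_right, pairing_smul_right, pairing_turn, det_self, hvm]; simp⟩
  simp only [Set.mem_ofPred_eq] at h1
  rw [pairing_add_right, pairing_smul_right] at h1
  have h2 : pairing (turn m) (toPlane (turn m)) = normSq m := by
    simp only [pairing, toPlane, turn, normSq]; push_cast; ring
  have h3 : (0 : ℝ) < normSq m := by exact_mod_cast hmp.normSq_pos
  rw [h2] at h1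
  nlinarith

/-- Among the covectors that are tight at a point of the wave front, the last one in
counterclockwise order is a side. -/
theorem exists_last_isSide (hΦ : IsBody Φ) {t : ℝ} (ht : 0 < t) (htT : t < finalTime Φ)
    {v : Plane} (hv : v ∈ propagation Φ t) {u : Lattice} (hu : IsPrimitive u)
    (huv : pairing u v = minValue Φ u + t) :
    ∃ n, IsSide (propagation Φ t) n ∧ pairing n v = minValue Φ n + t ∧
      ∀ k, IsPrimitive k → pairing k v = minValue Φ k + t → det n k ≤ 0 := by
  classical
  obtain ⟨x, hx⟩ := hΦ.exists_pairing_gt ht.le htT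
  have hmemX : ∀ k, IsPrimitive k → pairing k v = minValue Φ k + t →
      k ∈ (tights Φ t).filter fun k => pairing k v = minValue Φ k + t := fun k hk hkv =>
    Finset.mem_filter.2 ⟨(hΦ.mem_tights ht).2 ⟨hk, v, hv, hkv⟩, hkv⟩
  obtain ⟨n, hn, hlast⟩ := exists_last
    ((tights Φ t).filter fun k => pairing k v = minValue Φ k + t) ⟨u, hmemX u hu huv⟩ (x - v)
    (fun k hk => by
      obtain ⟨hk1, hk2⟩ := Finset.mem_filter.1 hk
      have := hx k ((hΦ.mem_tights ht).1 hk1).1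
      rw [pairing_sub_right]; linarith)
  obtain ⟨hn1, hnv⟩ := Finset.mem_filter.1 hn
  have hnp := ((hΦ.mem_tights ht).1 hn1).1
  have hlast' : ∀ k, IsPrimitive k → pairing k v = minValue Φ k + t → det n k ≤ 0 :=
    fun k hk hkv => hlast k (hmemX k hk hkv)
  obtain ⟨ε, hε, hmem⟩ := hΦ.exists_add_smul_mem ht hv (toPlane (turn n)) (fun k hk hkv => by
    rw [pairing_turn]
    have : (det n k : ℝ) ≤ 0 := by exact_mod_cast hlast' k hk hkv
    linarith)
  refine ⟨n, ⟨hnp, v, hΦ.mem_face_of_tight hnp hv hnv, v + ε • toPlane (turn n),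
    hΦ.mem_face_of_tight hnp hmem ?_, ?_⟩, hnv, hlast'⟩
  · rw [pairing_add_right, pairing_smul_right, pairing_turn, det_self, hnv]; simp
  · intro h0
    have h1 := congrArg (pairing (turn n)) h0
    rw [pairing_add_right, pairing_smul_right] at h1
    have h2 : pairing (turn n) (toPlane (turn n)) = normSq n := by
      simp only [pairing, toPlane, turn, normSq]; push_cast; ring
    have h3 : (0 : ℝ) < normSq n := by exact_mod_cast hnp.normSq_pos
    rw [h2] at h1
    nlinarith

/-- Every side of a wave front is followed by another one, with which it has a vertex in common. -/
theorem exists_isNext_sides (hΦ : IsBody Φ) {t : ℝ} (ht : 0 < t) (htT : t < finalTime Φ)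
    {m : Lattice} (hm : IsSide (propagation Φ t) m) : ∃ n, IsNext (sides Φ t) m n ∧
      ∃ v, IsVertexBetween (propagation Φ t) m n v := by
  obtain ⟨v, hv, hmv, k, hk, hkv, hmk⟩ :=
    hΦ.exists_tight_det_pos ht (hΦ.mem_tightSet_of_isSide ht hm)
  obtain ⟨n, hn, hnv, hlast⟩ := hΦ.exists_last_isSide ht htT hv hk hkv
  have hmn : 0 < det m n := by
    have h1 := hlast m hm.1 hmv
    rw [det_swap] at h1
    rcases (neg_nonpos.1 h1).eq_or_lt with h | h
    · exfalso
      rcases eq_or_eq_neg_of_det_eq_zero hm.1 hn.1 h.symm with rfl | rfl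
      · linarith [hlast k hk hkv]
      · obtain ⟨x, hx⟩ := hΦ.exists_pairing_gt ht.le htT
        have a1 := hx m hm.1
        have a2 := hx (-m) hn.1
        rw [pairing_neg_left] at a2 hnv
        linarith
    · exact h
  have hmf := hΦ.mem_face_of_tight hm.1 hv hmv
  have hnf := hΦ.mem_face_of_tight hn.1 hv hnv
  refine ⟨n, ⟨(hΦ.mem_sides ht).2 hm, (hΦ.mem_sides ht).2 hn, hmn, ?_⟩,
    v, hm, hn, hmn, hmf, hnf⟩
  rintro l hl ⟨h1, h2⟩
  exact subsingleton_face_of_between hmf hnf hmn h1 h2 ((hΦ.mem_sides ht).1 hl).2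

/-- The sides of a wave front form a complete fan. -/
theorem isFan_sides (hΦ : IsBody Φ) {t : ℝ} (ht : 0 < t) (htT : t < finalTime Φ) :
    IsFan (sides Φ t) := by
  refine ⟨?_, fun m hm => ((hΦ.mem_sides ht).1 hm).1, fun m hm => ?_⟩
  · obtain ⟨v, hv, hmin⟩ := (hΦ.isCompact_propagation t).exists_isMinOn
      ((interior_propagation_nonempty ht.le htT).mono interior_subset)
      (continuous_pairing (1, 0)).continuousOn
    obtain ⟨u, hu, huv⟩ : ∃ u, IsPrimitive u ∧ pairing u v = minValue Φ u + t := by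
      by_contra hcon
      push Not at hcon
      obtain ⟨ε, hε, hmem⟩ := hΦ.exists_add_smul_mem ht hv (-1, 0)
        (fun k hk hkv => (hcon k hk hkv).elim)
      have := hmin hmem
      simp only [Set.mem_ofPred_eq, pairing_add_right, pairing_smul_right] at this
      simp only [pairing] at this
      push_cast at this
      linarith
    obtain ⟨n, hn, -⟩ := hΦ.exists_last_isSide ht htT hv hu huv
    exact ⟨n, (hΦ.mem_sides ht).2 hn⟩
  · obtain ⟨n, hn, -⟩ := hΦ.exists_isNext_sides ht htT ((hΦ.mem_sides ht).1 hm)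
    exact ⟨n, hn⟩

/-- Two sides have a vertex in common if and only if they are consecutive. -/
theorem exists_isVertexBetween_iff (hΦ : IsBody Φ) {t : ℝ} (ht : 0 < t) (htT : t < finalTime Φ)
    {m n : Lattice} :
    (∃ v, IsVertexBetween (propagation Φ t) m n v) ↔ IsNext (sides Φ t) m n := by
  constructor
  · rintro ⟨v, hm, hn, hmn, hmv, hnv⟩
    refine ⟨(hΦ.mem_sides ht).2 hm, (hΦ.mem_sides ht).2 hn, hmn, ?_⟩
    rintro l hl ⟨h1, h2⟩
    exact subsingleton_face_of_between hmv hnv hmn h1 h2 ((hΦ.mem_sides ht).1 hl).2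
  · intro h
    obtain ⟨n', hn', hv⟩ := hΦ.exists_isNext_sides ht htT ((hΦ.mem_sides ht).1 h.1)
    rwa [(hΦ.isFan_sides ht htT).next_unique h hn']

/-- Every tight covector is followed by another one, at height one over it. -/
theorem exists_isNext_tights (hΦ : IsBody Φ) {t : ℝ} (ht : 0 < t) (htT : t < finalTime Φ)
    {m : Lattice} (hm : m ∈ tightSet Φ t) : ∃ n, (IsNext (tights Φ t) m n ∧ det m n = 1) ∧
      ∃ v ∈ propagation Φ t, pairing m v = minValue Φ m + t ∧ pairing n v = minValue Φ n + t := by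
  classical
  obtain ⟨v, hv, hmv, k, hk, hkv, hmk⟩ := hΦ.exists_tight_det_pos ht hm
  obtain ⟨x, hx⟩ := hΦ.exists_pairing_gt ht.le htT
  have hmemX : ∀ k, IsPrimitive k → pairing k v = minValue Φ k + t → 0 < det m k →
      k ∈ (tights Φ t).filter fun k => pairing k v = minValue Φ k + t ∧ 0 < det m k :=
    fun k hk hkv hmk => Finset.mem_filter.2 ⟨(hΦ.mem_tights ht).2 ⟨hk, v, hv, hkv⟩, hkv, hmk⟩
  obtain ⟨n, hn, hfirst⟩ := exists_first
    ((tights Φ t).filter fun k => pairing k v = minValue Φ k + t ∧ 0 < det m k)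
    ⟨k, hmemX k hk hkv hmk⟩ (x - v) (fun k hk => by
      obtain ⟨hk1, hk2, -⟩ := Finset.mem_filter.1 hk
      have := hx k ((hΦ.mem_tights ht).1 hk1).1
      rw [pairing_sub_right]; linarith)
  obtain ⟨hnL, hnv, hmn⟩ := Finset.mem_filter.1 hn
  have hnp := ((hΦ.mem_tights ht).1 hnL).1
  have hmf := hΦ.mem_face_of_tight hm.1 hv hmv
  have hnf := hΦ.mem_face_of_tight hnp hv hnv
  have hbetween : ∀ l ∈ tightSet Φ t, ¬(0 < det m l ∧ 0 < det l n) := by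
    rintro l hl ⟨h1, h2⟩
    have hlv : v ∈ face (propagation Φ t) l := by
      rw [face_eq_singleton hmf hnf hmn h1 h2]; rfl
    have := hfirst l (hmemX l hl.1 ((hΦ.mem_face_iff hl).1 hlv).2 h1)
    rw [det_swap] at this
    linarith
  refine ⟨n, ⟨⟨(hΦ.mem_tights ht).2 hm, hnL, hmn,
    fun l hl => hbetween l ((hΦ.mem_tights ht).1 hl)⟩, ?_⟩, v, hv, hmv, hnv⟩
  -- Otherwise the lowest lattice point of the cone at height one over `m` is tight as well.
  by_contra hne
  obtain ⟨l, hl1, hl2, hl3⟩ := hm.1.exists_det_eq_one_of_det_pos hmn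
  have hlp := isPrimitive_of_det_eq_one' hl1
  have hl0 : 0 < det l n := by
    rcases hl2.eq_or_lt with h | h
    · rcases eq_or_eq_neg_of_det_eq_zero hlp hnp h.symm with e | e
      · exact (hne (e ▸ hl1)).elim
      · rw [e] at hmn
        simp only [det, Prod.fst_neg, Prod.snd_neg] at hmn hl1
        linarith
    · exact h
  have hcr := det_smul_eq m n l
  rw [hl1] at hcr
  have htl := hΦ.tight_of_tight ht.le hv hlp hmv hnv hl2 zero_le_one hmn (by linarith) hcr
  exact hbetween l ⟨hlp, v, hv, htl⟩ ⟨by rw [hl1]; exact one_pos, hl0⟩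

/-- The tight covectors form a smooth fan. -/
theorem isSmoothFan_tights (hΦ : IsBody Φ) {t : ℝ} (ht : 0 < t) (htT : t < finalTime Φ) :
    IsSmoothFan (tights Φ t) := by
  refine isSmoothFan_of_exists ?_ (fun m hm => ((hΦ.mem_tights ht).1 hm).1) fun m hm => ?_
  · exact (hΦ.isFan_sides ht htT).nonempty.mono (hΦ.sides_subset_tights ht)
  · obtain ⟨n, hn, -⟩ := hΦ.exists_isNext_tights ht htT ((hΦ.mem_tights ht).1 hm)
    exact ⟨n, hn⟩

theorem exists_vertex_of_isNext_tights (hΦ : IsBody Φ) {t : ℝ} (ht : 0 < t)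
    (htT : t < finalTime Φ) {m n : Lattice} (h : IsNext (tights Φ t) m n) :
    ∃ v ∈ propagation Φ t, pairing m v = minValue Φ m + t ∧ pairing n v = minValue Φ n + t := by
  obtain ⟨n', hn', hv⟩ := hΦ.exists_isNext_tights ht htT ((hΦ.mem_tights ht).1 h.1)
  rwa [(hΦ.isSmoothFan_tights ht htT).next_unique h hn'.1]

/-! ### Evolution of the wave front -/

/-- The wave front of a wave front is a wave front. -/
theorem propagation_propagation (hΦ : IsBody Φ) {s : ℝ} (hs : 0 < s) (hsT : s < finalTime Φ)
    {t : ℝ} (ht : 0 ≤ t) : propagation (propagation Φ s) t = propagation Φ (s + t) := by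
  have hP := hΦ.isBody_propagation hs.le hsT
  have hfan := hΦ.isSmoothFan_tights hs hsT
  ext p
  rw [hP.mem_propagation_iff, hΦ.mem_propagation_iff]
  constructor
  · intro h m hm
    obtain ⟨q, hq, hqm⟩ := hP.exists_eq_minValue m
    have := hΦ.mem_propagation_iff.1 hq m hm
    linarith [h m hm]
  · intro h m hm
    obtain ⟨u, n, hun, hc1, hc2⟩ := hfan.exists_inCone hm.ne_zero
    obtain ⟨v, hv, huv, hnv⟩ := hΦ.exists_vertex_of_isNext_tights hs hsT hun
    have hd := hfan.det_eq_one u n hun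
    have e1 := det_mul_pairing u n m v
    have e2 := det_mul_pairing u n m p
    rw [hd, Int.cast_one, one_mul] at e1 e2
    have h1 := h u (hfan.primitive u hun.1)
    have h2 := h n (hfan.primitive n hun.2.1)
    have h3 := hP.minValue_le m hv
    have h4 : (0 : ℝ) ≤ det u m := by exact_mod_cast hc1
    have h5 : (1 : ℝ) ≤ det m n := by exact_mod_cast hc2
    rw [huv, hnv] at e1
    nlinarith [mul_le_mul_of_nonneg_left h1 (zero_le_one.trans h5),
      mul_le_mul_of_nonneg_left h2 h4, mul_le_mul_of_nonneg_right h5 ht, mul_nonneg h4 ht]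

theorem finalTime_propagation (hΦ : IsBody Φ) {s : ℝ} (hs : 0 < s) (hsT : s < finalTime Φ) :
    finalTime (propagation Φ s) = finalTime Φ - s := by
  have hP := hΦ.isBody_propagation hs.le hsT
  refine le_antisymm ?_ ?_
  · refine csInf_le ⟨0, fun _ h => h.1⟩ ⟨by linarith, ?_⟩
    rw [hΦ.propagation_propagation hs hsT (by linarith), add_sub_cancel]
    exact hΦ.interior_finalLocus
  · refine le_csInf hP.exists_interior_eq_empty fun t ⟨h0, he⟩ => ?_
    rw [hΦ.propagation_propagation hs hsT h0] at he
    by_contra hcon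
    exact (interior_propagation_nonempty (Φ := Φ) (t := s + t) (by linarith)
      (by linarith)).ne_empty he

theorem finalLocus_propagation (hΦ : IsBody Φ) {s : ℝ} (hs : 0 < s) (hsT : s < finalTime Φ) :
    finalLocus (propagation Φ s) = finalLocus Φ := by
  rw [finalLocus, hΦ.finalTime_propagation hs hsT,
    hΦ.propagation_propagation hs hsT (by linarith), add_sub_cancel, finalLocus]

/-- Tight covectors were tight before. -/
theorem tights_antitone (hΦ : IsBody Φ) {s t : ℝ} (hs : 0 < s) (hsT : s < finalTime Φ)
    (hst : s ≤ t) : tights Φ t ⊆ tights Φ s := by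
  intro m hm
  obtain ⟨hmp, p, hp, hpm⟩ := (hΦ.mem_tights (hs.trans_le hst)).1 hm
  have hP := hΦ.isBody_propagation hs.le hsT
  obtain ⟨q, hq, hqm⟩ := hP.exists_eq_minValue m
  refine (hΦ.mem_tights hs).2 ⟨hmp, q, hq, le_antisymm ?_ (hΦ.mem_propagation_iff.1 hq m hmp)⟩
  have hp' : p ∈ propagation (propagation Φ s) (t - s) := by
    rw [hΦ.propagation_propagation hs hsT (by linarith), add_sub_cancel]; exact hp
  have := hP.mem_propagation_iff.1 hp' m hmp
  rw [hqm]
  linarith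

/-- Sides were sides before: the wave front acquires no new sides. -/
theorem sides_antitone (hΦ : IsBody Φ) {s t : ℝ} (hs : 0 < s) (hsT : s < finalTime Φ)
    (hst : s ≤ t) : sides Φ t ⊆ sides Φ s := by
  intro k hk
  have ht := hs.trans_le hst
  have hside := (hΦ.mem_sides ht).1 hk
  have htight := hΦ.mem_tightSet_of_isSide ht hside
  have hFan := hΦ.isFan_sides hs hsT
  obtain ⟨m, n, hmn, hc⟩ := hFan.exists_inCone hside.1.ne_zero
  have hc2 := hc.2
  rcases hc.eq_or_det_pos (hFan.primitive m hmn.1) hside.1 hmn.2.2.1 with rfl | h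
  · exact hmn.1
  · exfalso
    obtain ⟨v, hm, hn, hpos, hmv, hnv⟩ := (hΦ.exists_isVertexBetween_iff hs hsT).2 hmn
    rw [hΦ.mem_face_iff (hΦ.mem_tightSet_of_isSide hs hm)] at hmv
    rw [hΦ.mem_face_iff (hΦ.mem_tightSet_of_isSide hs hn)] at hnv
    have hheight := hΦ.le_add_of_tight hs hmv.1 hside.1 hmv.2 hnv.2 hc2.le h.le hpos
      (det_smul_eq m n k)
    have hks := (hΦ.mem_tights hs).1 (hΦ.tights_antitone hs hsT hst ((hΦ.mem_tights ht).2 htight))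
    have hkv : pairing k v = minValue Φ k + s := by
      refine ((hΦ.mem_face_iff hks).1 ?_).2
      rw [face_eq_singleton ((hΦ.mem_face_iff (hΦ.mem_tightSet_of_isSide hs hm)).2 hmv)
        ((hΦ.mem_face_iff (hΦ.mem_tightSet_of_isSide hs hn)).2 hnv) hpos h hc2]
      rfl
    -- On the face of `k` at time `t`, both `m` and `n` have their least possible values.
    have key : ∀ q ∈ face (propagation Φ t) k,
        pairing m q = minValue Φ m + t ∧ pairing n q = minValue Φ n + t := by
      intro q hq
      obtain ⟨hqP, hqk⟩ := (hΦ.mem_face_iff htight).1 hq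
      have h1 := hΦ.mem_propagation_iff.1 hqP m hm.1
      have h2 := hΦ.mem_propagation_iff.1 hqP n hn.1
      have e1 := det_mul_pairing m n k v
      have e2 := det_mul_pairing m n k q
      rw [hkv, hmv.2, hnv.2] at e1
      rw [hqk] at e2
      have g1 : (0 : ℝ) < det k n := by exact_mod_cast hc2
      have g2 : (0 : ℝ) < det m k := by exact_mod_cast h
      have g3 : (det m n : ℝ) ≤ det k n + det m k := by exact_mod_cast hheight
      have g4 := mul_le_mul_of_nonneg_right g3 (sub_nonneg.2 hst)
      have g5 := mul_nonneg g1.le (sub_nonneg.2 h1)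
      have g6 := mul_nonneg g2.le (sub_nonneg.2 h2)
      have g7 : (det k n : ℝ) * (pairing m q - (minValue Φ m + t)) ≤ 0 := by nlinarith
      have g8 : (det m k : ℝ) * (pairing n q - (minValue Φ n + t)) ≤ 0 := by nlinarith
      constructor
      · linarith [nonpos_of_mul_nonpos_right g7 g1]
      · linarith [nonpos_of_mul_nonpos_right g8 g2]
    obtain ⟨-, p, hp, q, hq, hpq⟩ := hside
    exact hpq (eq_of_pairing_eq hpos.ne' (by rw [(key p hp).1, (key q hq).1])
      (by rw [(key p hp).2, (key q hq).2]))

end IsBody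

/-! ### Tropical length and perimeter -/

theorem tropicalLength_nonneg (S : Set Plane) : 0 ≤ tropicalLength S := by
  rcases S.eq_empty_or_nonempty with rfl | ⟨p, hp⟩
  · simp [tropicalLength]
  · exact Real.sSup_nonneg' ⟨0, ⟨(1, 0), by simp [IsPrimitive], p, hp, by simpa using hp⟩, le_rfl⟩

theorem toPlane_ne_zero {u : Lattice} (hu : IsPrimitive u) : toPlane u ≠ 0 := by
  intro h
  apply hu.ne_zero
  simp only [toPlane, Prod.mk_eq_zero, Int.cast_eq_zero] at h
  exact Prod.ext h.1 h.2

theorem tropicalLength_of_subsingleton {S : Set Plane} (hS : S.Subsingleton) :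
    tropicalLength S = 0 := by
  refine le_antisymm (Real.sSup_nonpos ?_) (tropicalLength_nonneg S)
  rintro s ⟨u, hu, p, hp, hps⟩
  have h := hS hps hp
  rw [add_eq_left, smul_eq_zero] at h
  exact (h.resolve_right (toPlane_ne_zero hu)).le

/-- The tropical length of a bounded subset of a line of rational slope is the difference of the
extreme values of the affine parameter. -/
theorem tropicalLength_image {u : Lattice} (hu : IsPrimitive u) (p : Plane) {A : Set ℝ}
    (hne : A.Nonempty) (hb : BddBelow A) (ha : BddAbove A) :
    tropicalLength ((fun r : ℝ => p + r • toPlane u) '' A) = sSup A - sInf A := by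
  have hub : ∀ s ∈ {s : ℝ | ∃ v : Lattice, IsPrimitive v ∧
      ∃ q ∈ (fun r : ℝ => p + r • toPlane u) '' A,
        q + s • toPlane v ∈ (fun r : ℝ => p + r • toPlane u) '' A}, s ≤ sSup A - sInf A := by
    rintro s ⟨v, hv, _, ⟨r, hr, rfl⟩, r', hr', h⟩
    have hA : ∀ {x y}, x ∈ A → y ∈ A → x - y ≤ sSup A - sInf A := fun hx hy =>
      sub_le_sub (le_csSup ha hx) (csInf_le hb hy)
    have h' : s • toPlane v = (r' - r) • toPlane u := by
      have : p + r' • toPlane u = p + r • toPlane u + s • toPlane v := h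
      rw [add_assoc, add_right_inj] at this
      rw [sub_smul, this, add_sub_cancel_left]
    rcases eq_or_ne s 0 with rfl | hs
    · simpa using hA hr hr
    · have hd : det u v = 0 := by
        have e1 := congrArg (pairing (turn u)) h'
        rw [pairing_smul_right, pairing_smul_right] at e1
        have e2 : pairing (turn u) (toPlane v) = -(det u v : ℝ) := by
          simp only [pairing, turn, toPlane, det]; push_cast; ring
        have e3 : pairing (turn u) (toPlane u) = 0 := by
          simp only [pairing, turn, toPlane]; push_cast; ring
        rw [e2, e3, mul_zero] at e1
        have := (mul_eq_zero.1 e1).resolve_left hs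
        exact_mod_cast neg_eq_zero.1 this
      rcases eq_or_eq_neg_of_det_eq_zero hu hv hd with rfl | rfl
      · have := smul_left_injective ℝ (toPlane_ne_zero hu) h'
        exact this ▸ hA hr' hr
      · have e : toPlane (-u) = -toPlane u := by simp [toPlane]
        rw [e, smul_neg, ← neg_smul] at h'
        have := smul_left_injective ℝ (toPlane_ne_zero hu) h'
        have h2 := hA hr hr'
        linarith
  have hmem : ∀ {x y}, x ∈ A → y ∈ A →
      x - y ≤ tropicalLength ((fun r : ℝ => p + r • toPlane u) '' A) := fun {x y} hx hy =>
    le_csSup ⟨_, hub⟩ ⟨u, hu, p + y • toPlane u, ⟨y, hy, rfl⟩, x, hx, by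
      simp only; rw [add_assoc, ← add_smul, add_sub_cancel]⟩
  obtain ⟨x, hx⟩ := hne
  refine le_antisymm (csSup_le ⟨0, u, hu, p + x • toPlane u, ⟨x, hx, rfl⟩, x, hx, by simp⟩ hub) ?_
  rw [sub_le_iff_le_add]
  refine csSup_le ⟨x, hx⟩ fun y hy => ?_
  rw [← sub_le_iff_le_add']
  exact le_csInf ⟨x, hx⟩ fun z hz => by linarith [hmem hy hz]

/-- The half-planes `{c m ≤ m}`, `m ∈ L`, contain `P`, and the intersection points of the boundary
lines for consecutive rays of `L` belong to `P`: the polygon `P` has its sides among `L`, and its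
normal fan is refined by the fan `L`. The set `P` may have empty interior. -/
structure Adapted (L : Finset Lattice) (P : Set Plane) (c : Lattice → ℝ) : Prop where
  le_pairing : ∀ m ∈ L, ∀ p ∈ P, c m ≤ pairing m p
  exists_vertex : ∀ m n, IsNext L m n → ∃ p ∈ P, pairing m p = c m ∧ pairing n p = c n

namespace Adapted

variable {L : Finset Lattice} {P : Set Plane} {c : Lattice → ℝ}

theorem mem_face (h : Adapted L P c) {m : Lattice} (hm : m ∈ L) {p : Plane} (hp : p ∈ P)
    (hmp : pairing m p = c m) : p ∈ face P m :=
  ⟨hp, fun q hq => hmp ▸ h.le_pairing m hm q hq⟩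

theorem mem_of_isSide (h : Adapted L P c) (hL : IsFan L) {k : Lattice} (hk : IsSide P k) :
    k ∈ L := by
  obtain ⟨m, n, hmn, hc⟩ := hL.exists_inCone hk.1.ne_zero
  rcases hc.eq_or_det_pos (hL.primitive m hmn.1) hk.1 hmn.2.2.1 with rfl | h0
  · exact hmn.1
  · obtain ⟨p, hp, hm, hn⟩ := h.exists_vertex m n hmn
    exact (subsingleton_face_of_between (h.mem_face hmn.1 hp hm) (h.mem_face hmn.2.1 hp hn)
      hmn.2.2.1 h0 hc.2 hk.2).elim

theorem perimeter_eq_sum (h : Adapted L P c) (hL : IsFan L) :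
    perimeter P = ∑ m ∈ L, tropicalLength (face P m) := by
  classical
  have key : ∀ m, (∑ᶠ (_ : IsSide P m), tropicalLength (face P m)) =
      if m ∈ L then tropicalLength (face P m) else 0 := by
    intro m
    rw [finsum_eq_if]
    by_cases hm : IsSide P m
    · rw [if_pos hm, if_pos (h.mem_of_isSide hL hm)]
    · rw [if_neg hm]
      split_ifs with hmL
      · rw [tropicalLength_of_subsingleton]
        exact Set.not_nontrivial_iff.1 fun hnt => hm ⟨hL.primitive m hmL, hnt⟩
      · rfl
  rw [perimeter, finsum_congr key, finsum_eq_sum_of_support_subset (s := L)]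
  · exact Finset.sum_congr rfl fun m hm => if_pos hm
  · intro m hm
    by_contra hmL
    exact hm (if_neg fun h => hmL (Finset.mem_coe.2 h))

theorem tropicalLength_face (h : Adapted L P c) (hL : IsSmoothFan L) {m n l : Lattice}
    (hmn : IsNext L m n) (hnl : IsNext L n l) :
    tropicalLength (face P n) = det m l * c n - c m - c l := by
  obtain ⟨v, hv, hvm, hvn⟩ := h.exists_vertex m n hmn
  obtain ⟨v', hv', hvn', hvl'⟩ := h.exists_vertex n l hnl
  have d1 := hL.det_eq_one m n hmn
  have d2 := hL.det_eq_one n l hnl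
  have hwm : pairing m (toPlane (turn n)) = 1 := by rw [pairing_turn, det_swap, d1]; simp
  have hwn : pairing n (toPlane (turn n)) = 0 := by rw [pairing_turn, det_self]; simp
  have hwl : pairing l (toPlane (turn n)) = -1 := by rw [pairing_turn, d2]; simp
  have hlv : pairing l v = det m l * c n - c m := by
    have := congrArg (fun k => pairing k v) (add_eq_smul_of_det_eq_one d1 d2)
    simp only [pairing_add_left, pairing_smul_left, hvm, hvn] at this
    linarith
  set ℓ := det m l * c n - c m - c l with hℓ
  have hℓ0 : 0 ≤ ℓ := by linarith [h.le_pairing l hnl.2.1 v hv]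
  have hline : ∀ q, pairing n q = c n → q = v + (pairing l v - pairing l q) • toPlane (turn n) := by
    intro q hq
    refine eq_of_pairing_eq (m := n) (n := l) (by rw [d2]; exact one_ne_zero) ?_ ?_
    · rw [pairing_add_right, pairing_smul_right, hwn, hvn, hq]; ring
    · rw [pairing_add_right, pairing_smul_right, hwl]; ring
  have hface : face P n = (fun r : ℝ => v + r • toPlane (turn n)) ''
      {r | (0 ≤ r ∧ r ≤ ℓ) ∧ v + r • toPlane (turn n) ∈ P} := by
    ext q
    constructor
    · intro hq
      have hqn : pairing n q = c n :=
        le_antisymm (hvn ▸ hq.2 v hv) (h.le_pairing n hmn.2.1 q hq.1)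
      have hql := hline q hqn
      refine ⟨pairing l v - pairing l q, ⟨⟨?_, ?_⟩, by rw [← hql]; exact hq.1⟩, hql.symm⟩
      · have h1 := h.le_pairing m hmn.1 q hq.1
        rw [hql, pairing_add_right, pairing_smul_right, hwm, hvm] at h1
        linarith
      · linarith [h.le_pairing l hnl.2.1 q hq.1]
    · rintro ⟨r, ⟨-, hr⟩, rfl⟩
      refine h.mem_face hmn.2.1 hr ?_
      rw [pairing_add_right, pairing_smul_right, hwn, hvn]; ring
  have hmax : IsGreatest {r | (0 ≤ r ∧ r ≤ ℓ) ∧ v + r • toPlane (turn n) ∈ P} ℓ := by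
    refine ⟨⟨⟨hℓ0, le_rfl⟩, ?_⟩, fun r hr => hr.1.2⟩
    have h1 := hline v' hvn'
    rw [hlv, hvl', ← hℓ] at h1
    rwa [← h1]
  have hmin : IsLeast {r | (0 ≤ r ∧ r ≤ ℓ) ∧ v + r • toPlane (turn n) ∈ P} 0 :=
    ⟨⟨⟨le_rfl, hℓ0⟩, by simpa using hv⟩, fun r hr => hr.1.1⟩
  rw [hface, tropicalLength_image (hL.primitive n hmn.2.1).turn v ⟨_, hmax.1⟩
    ⟨_, hmin.2⟩ ⟨_, hmax.2⟩, hmax.csSup_eq, hmin.csInf_eq, sub_zero]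

/-- The tropical perimeter as a linear function of the constants `c`. -/
theorem perimeter_eq (h : Adapted L P c) (hL : IsSmoothFan L) {nx : Lattice → Lattice}
    (hnx : ∀ m ∈ L, IsNext L m (nx m)) :
    perimeter P = ∑ m ∈ L, (det m (nx (nx m)) * c (nx m) - c m - c (nx (nx m))) := by
  rw [h.perimeter_eq_sum hL.toIsFan, ← hL.sum_next hnx]
  exact Finset.sum_congr rfl fun m hm =>
    h.tropicalLength_face hL (hnx m hm) (hnx _ (hnx m hm).2.1)

end Adapted

namespace IsBody

variable {Φ : Set Plane}

/-- A fan that consists of the tight covectors during an open interval of time is adapted to the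
wave front in the closed interval. -/
theorem adapted_of_const (hΦ : IsBody Φ) {a b : ℝ} (ha : 0 ≤ a) (hab : a < b)
    (hb : b ≤ finalTime Φ) {L : Finset Lattice} (hL : ∀ t ∈ Set.Ioo a b, tights Φ t = L) {t : ℝ}
    (ht : t ∈ Set.Icc a b) : Adapted L (propagation Φ t) fun m => minValue Φ m + t := by
  have hsm : IsSmoothFan L := by
    obtain ⟨r, hr⟩ := exists_between hab
    rw [← hL r hr]
    exact hΦ.isSmoothFan_tights (ha.trans_lt hr.1) (hr.2.trans_le hb)
  refine ⟨fun m hm p hp => hΦ.mem_propagation_iff.1 hp m (hsm.primitive m hm), fun m n hmn => ?_⟩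
  have hd := hsm.det_eq_one m n hmn
  have hd' : (m.1 : ℝ) * n.2 - m.2 * n.1 = 1 := by
    have : ((det m n : ℤ) : ℝ) = 1 := by rw [hd]; simp
    simpa [det] using this
  -- The intersection point of the two boundary lines at time `r`.
  let v : ℝ → Plane := fun r => ((minValue Φ m + r) * n.2 - (minValue Φ n + r) * m.2,
    (minValue Φ n + r) * m.1 - (minValue Φ m + r) * n.1)
  have hvm : ∀ r, pairing m (v r) = minValue Φ m + r := fun r => by
    simp only [v, pairing]; linear_combination (minValue Φ m + r) * hd'
  have hvn : ∀ r, pairing n (v r) = minValue Φ n + r := fun r => by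
    simp only [v, pairing]; linear_combination (minValue Φ n + r) * hd'
  refine ⟨v t, hΦ.mem_propagation_iff.2 fun k hk => ?_, hvm t, hvn t⟩
  have hcl : IsClosed {r | minValue Φ k + r ≤ pairing k (v r)} := by
    refine isClosed_le (by fun_prop) ((continuous_pairing k).comp ?_)
    simp only [v]
    fun_prop
  have hsub : Set.Ioo a b ⊆ {r | minValue Φ k + r ≤ pairing k (v r)} := by
    intro r hr
    have h0 : 0 < r := ha.trans_lt hr.1
    have hrT : r < finalTime Φ := hr.2.trans_le hb
    obtain ⟨w, hw, hwm, hwn⟩ := hΦ.exists_vertex_of_isNext_tights h0 hrT (by rwa [hL r hr])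
    have : v r = w := eq_of_pairing_eq (m := m) (n := n) (by rw [hd]; exact one_ne_zero)
      (by rw [hvm, hwm]) (by rw [hvn, hwn])
    rw [Set.mem_ofPred_eq, this]
    exact hΦ.mem_propagation_iff.1 hw k hk
  have := closure_minimal hsub hcl
  rw [closure_Ioo hab.ne] at this
  exact this ht

/-- While the set of tight covectors is constant, with `N` elements, the perimeter grows at the
rate `N - 12`. -/
theorem perimeter_sub_perimeter (hΦ : IsBody Φ) {a b : ℝ} (ha : 0 ≤ a) (hab : a < b)
    (hb : b ≤ finalTime Φ) {L : Finset Lattice} (hL : ∀ t ∈ Set.Ioo a b, tights Φ t = L) :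
    perimeter (propagation Φ b) - perimeter (propagation Φ a) = (L.card - 12) * (b - a) := by
  have hsm : IsSmoothFan L := by
    obtain ⟨r, hr⟩ := exists_between hab
    rw [← hL r hr]
    exact hΦ.isSmoothFan_tights (ha.trans_lt hr.1) (hr.2.trans_le hb)
  obtain ⟨nx, hnx⟩ := hsm.exists_next_fun
  rw [(hΦ.adapted_of_const ha hab hb hL (Set.right_mem_Icc.2 hab.le)).perimeter_eq hsm hnx,
    (hΦ.adapted_of_const ha hab hb hL (Set.left_mem_Icc.2 hab.le)).perimeter_eq hsm hnx,
    ← Finset.sum_sub_distrib]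
  have h12 : (∑ m ∈ L, (det m (nx (nx m)) : ℝ)) = 3 * (L.card : ℝ) - 12 := by
    exact_mod_cast hsm.sum_det_next hnx
  calc _ = ∑ m ∈ L, ((det m (nx (nx m)) : ℝ) - 2) * (b - a) :=
        Finset.sum_congr rfl fun m _ => by ring
    _ = _ := by
        rw [← Finset.sum_mul, Finset.sum_sub_distrib, h12, Finset.sum_const, nsmul_eq_mul]
        ring

end IsBody

/-! ### The final locus -/

/-- A convex set with empty interior in the plane lies on a line. -/
theorem exists_eq_add_smul_of_interior_eq_empty {P : Set Plane} (hP : Convex ℝ P)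
    (hint : interior P = ∅) {p q : Plane} (hp : p ∈ P) (hq : q ∈ P) (hpq : p ≠ q) {x : Plane}
    (hx : x ∈ P) : ∃ r : ℝ, x = p + r • (q - p) := by
  have hspan : vectorSpan ℝ P ≠ ⊤ := by
    intro h
    rw [← AffineSubspace.affineSpan_eq_top_iff_vectorSpan_eq_top_of_nonempty ℝ Plane Plane ⟨p, hp⟩,
      ← hP.interior_nonempty_iff_affineSpan_eq_top, hint] at h
    exact Set.not_nonempty_empty h
  have hcol : Collinear ℝ P := by
    rw [collinear_iff_finrank_le_one]
    have h1 : Module.finrank ℝ (vectorSpan ℝ P) < 2 := by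
      simpa using Submodule.finrank_lt hspan
    omega
  obtain ⟨v, hv⟩ := (collinear_iff_of_mem hp).1 hcol
  obtain ⟨a, rfl⟩ := hv q hq
  obtain ⟨b, rfl⟩ := hv x hx
  simp only [vadd_eq_add] at hpq ⊢
  have ha : a ≠ 0 := by rintro rfl; simp at hpq
  refine ⟨b / a, ?_⟩
  rw [add_sub_cancel_right, smul_smul, div_mul_cancel₀ _ ha, add_comm]

/-- The perimeter of a degenerate polygon counts its length twice, once for each side. -/
theorem Adapted.perimeter_of_interior_eq_empty {L : Finset Lattice} {P : Set Plane}
    {c : Lattice → ℝ} (h : Adapted L P c) (hL : IsFan L) (hP : Convex ℝ P)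
    (hint : interior P = ∅) : perimeter P = 2 * tropicalLength P := by
  classical
  rcases P.subsingleton_or_nontrivial with hS | ⟨p, hp, q, hq, hpq⟩
  · have key : ∀ m, (∑ᶠ (_ : IsSide P m), tropicalLength (face P m)) = 0 := fun m => by
      rw [finsum_eq_if, if_neg]
      exact fun hm => Set.not_nontrivial_iff.2 (hS.anti fun _ h => h.1) hm.2
    rw [tropicalLength_of_subsingleton hS, perimeter, finsum_congr key, finsum_zero, mul_zero]
  have hd : q - p ≠ 0 := sub_ne_zero.2 hpq.symm
  have hline : ∀ x ∈ P, ∃ r : ℝ, x = p + r • (q - p) := fun x hx =>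
    exists_eq_add_smul_of_interior_eq_empty hP hint hp hq hpq hx
  -- The fan has a ray that is perpendicular to the line through `P`: otherwise a cone would contain
  -- a perpendicular covector in its interior, and its vertex would be the only point of `P`.
  obtain ⟨u, hu, hud⟩ : ∃ u ∈ L, pairing u (q - p) = 0 := by
    obtain ⟨m, n, hmn, hm, hn⟩ := hL.exists_next_crossing hd
    refine ⟨n, hmn.2.1, ?_⟩
    by_contra hne
    have hn' := lt_of_le_of_ne hn hne
    obtain ⟨v, hv, hvm, hvn⟩ := h.exists_vertex m n hmn
    obtain ⟨r, rfl⟩ := hline v hv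
    have h1 := h.le_pairing m hmn.1 p hp
    have h2 := h.le_pairing n hmn.2.1 q hq
    rw [← hvm, pairing_add_right, pairing_smul_right] at h1
    rw [← hvn, pairing_add_right, pairing_smul_right] at h2
    rw [pairing_sub_right] at *
    have : r ≤ 0 := by by_contra hr; push Not at hr; nlinarith
    nlinarith
  have hup := hL.primitive u hu
  have hconst : ∀ x ∈ P, pairing u x = pairing u p := fun x hx => by
    obtain ⟨r, rfl⟩ := hline x hx
    rw [pairing_add_right, pairing_smul_right, hud, mul_zero, add_zero]
  have hface : ∀ m ∈ ({u, -u} : Finset Lattice), face P m = P := by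
    intro m hm
    refine Set.Subset.antisymm (fun _ h => h.1) fun x hx => ⟨hx, fun y hy => ?_⟩
    rcases Finset.mem_insert.1 hm with rfl | hm
    · rw [hconst x hx, hconst y hy]
    · rw [Finset.mem_singleton.1 hm, pairing_neg_left, pairing_neg_left, hconst x hx, hconst y hy]
  have hside : ∀ m, IsSide P m ↔ m ∈ ({u, -u} : Finset Lattice) := by
    intro m
    constructor
    · rintro ⟨hm, x, hx, y, hy, hxy⟩
      have hd : det u m = 0 := by
        by_contra hd
        exact hxy (eq_of_pairing_eq hd (by rw [hconst x hx.1, hconst y hy.1])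
          (le_antisymm (hx.2 y hy.1) (hy.2 x hx.1)))
      simpa using eq_or_eq_neg_of_det_eq_zero hup hm hd
    · intro hm
      refine ⟨?_, by rw [hface m hm]; exact ⟨p, hp, q, hq, hpq⟩⟩
      rcases Finset.mem_insert.1 hm with rfl | hm
      · exact hup
      · rw [Finset.mem_singleton.1 hm]; exact hup.neg
  have hne : u ≠ -u := by
    intro h0
    apply hup.ne_zero
    have h1 := congrArg Prod.fst h0
    have h2 := congrArg Prod.snd h0
    simp only [Prod.fst_neg, Prod.snd_neg] at h1 h2
    exact Prod.ext (by simp only [Prod.fst_zero]; omega) (by simp only [Prod.snd_zero]; omega)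
  have key : ∀ m, (∑ᶠ (_ : IsSide P m), tropicalLength (face P m)) =
      if m ∈ ({u, -u} : Finset Lattice) then tropicalLength P else 0 := by
    intro m
    rw [finsum_eq_if]
    by_cases hm : IsSide P m
    · rw [if_pos hm, if_pos ((hside m).1 hm), hface m ((hside m).1 hm)]
    · rw [if_neg hm, if_neg fun h => hm ((hside m).2 h)]
  rw [perimeter, finsum_congr key, finsum_eq_sum_of_support_subset (s := {u, -u})]
  · rw [Finset.sum_congr rfl fun m hm => if_pos hm, Finset.sum_const, Finset.card_pair hne,
      nsmul_eq_mul]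
    norm_num
  · intro m hm
    by_contra hmL
    exact hm (if_neg fun h => hmL (Finset.mem_coe.2 h))

/-! ### Intervals of constancy -/

/-- A decreasing family of finite sets is constant just before `t`. -/
theorem exists_const_left {f : ℝ → Finset Lattice} {t : ℝ} (ht : 0 < t)
    (hf : ∀ r s, 0 < r → r ≤ s → s < t → f s ⊆ f r) :
    ∃ a, 0 < a ∧ a < t ∧ ∀ r ∈ Set.Ico a t, f r = f a := by
  obtain ⟨a, ha, hmin⟩ := (measure fun r => (f r).card).wf.has_min (Set.Ioo 0 t)
    (Set.nonempty_Ioo.2 ht)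
  exact ⟨a, ha.1, ha.2, fun r hr => Finset.eq_of_subset_of_card_le (hf a r ha.1 hr.1 hr.2)
    (not_lt.1 (hmin r ⟨ha.1.trans_le hr.1, hr.2⟩))⟩

/-- A decreasing family of finite sets is constant just after `t`. -/
theorem exists_const_right {f : ℝ → Finset Lattice} {t T : ℝ} (ht : t < T)
    (hf : ∀ r s, t ≤ r → r ≤ s → s < T → f s ⊆ f r) :
    ∃ b, t < b ∧ b < T ∧ ∀ r ∈ Set.Ioc t b, f r = f b := by
  obtain ⟨b, hb, hmin⟩ := (measure fun r => (f t).card - (f r).card).wf.has_min (Set.Ioo t T)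
    (Set.nonempty_Ioo.2 ht)
  refine ⟨b, hb.1, hb.2, fun r hr => ?_⟩
  have hrT := hr.2.trans_lt hb.2
  refine (Finset.eq_of_subset_of_card_le (hf r b hr.1.le hr.2 hb.2) ?_).symm
  have h1 : (f t).card - (f b).card ≤ (f t).card - (f r).card := not_lt.1 (hmin r ⟨hr.1, hrT⟩)
  have h2 := Finset.card_le_card (hf t r le_rfl hr.1.le hrT)
  have h3 := Finset.card_le_card (hf t b le_rfl hb.1.le hb.2)
  omega

namespace IsBody

variable {Φ : Set Plane}

/-- Before every time there is an interval in which no combinatorial change occurs. -/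
theorem exists_constant_before (hΦ : IsBody Φ) {t : ℝ} (ht : 0 < t) (htT : t ≤ finalTime Φ) :
    ∃ a, 0 < a ∧ a < t ∧ ∀ s, a ≤ s → ∃ L S : Finset Lattice,
      ∀ r ∈ Set.Ioo s t, tights Φ r = L ∧ sides Φ r = S := by
  obtain ⟨a, ha, hat, h⟩ := exists_const_left (f := tights Φ) ht fun r s hr hrs hs =>
    hΦ.tights_antitone hr ((hrs.trans_lt hs).trans_le htT) hrs
  obtain ⟨a', ha', hat', h'⟩ := exists_const_left (f := sides Φ) ht fun r s hr hrs hs =>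
    hΦ.sides_antitone hr ((hrs.trans_lt hs).trans_le htT) hrs
  exact ⟨max a a', lt_max_of_lt_left ha, max_lt hat hat', fun s hs => ⟨_, _, fun r hr =>
    ⟨h r ⟨(le_max_left _ _).trans (hs.trans hr.1.le), hr.2⟩,
      h' r ⟨(le_max_right _ _).trans (hs.trans hr.1.le), hr.2⟩⟩⟩⟩

/-- After every time before the final time there is an interval in which no combinatorial change
occurs. -/
theorem exists_constant_after (hΦ : IsBody Φ) {t : ℝ} (ht : 0 < t) (htT : t < finalTime Φ) :
    ∃ b, t < b ∧ b < finalTime Φ ∧ ∀ s ≤ b, ∃ L S : Finset Lattice,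
      ∀ r ∈ Set.Ioo t s, tights Φ r = L ∧ sides Φ r = S := by
  obtain ⟨b, hb, hbt, h⟩ := exists_const_right (f := tights Φ) htT fun r s hr hrs hs =>
    hΦ.tights_antitone (ht.trans_le hr) (hrs.trans_lt hs) hrs
  obtain ⟨b', hb', hbt', h'⟩ := exists_const_right (f := sides Φ) htT fun r s hr hrs hs =>
    hΦ.sides_antitone (ht.trans_le hr) (hrs.trans_lt hs) hrs
  exact ⟨min b b', lt_min hb hb', min_lt_of_left_lt hbt, fun s hs => ⟨_, _, fun r hr =>
    ⟨h r ⟨hr.1, hr.2.le.trans (hs.trans (min_le_left _ _))⟩,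
      h' r ⟨hr.1, hr.2.le.trans (hs.trans (min_le_right _ _))⟩⟩⟩⟩

/-! ### Widths of vertices -/

/-- The dual cone of a vertex of a wave front has height one: its lattice height is the quotient of
its determinant by its width. -/
theorem exists_eq_add_width_smul (hΦ : IsBody Φ) {t : ℝ} (ht : 0 < t) {m n : Lattice} {v : Plane}
    (h : IsVertexBetween (propagation Φ t) m n v) :
    ∃ d, n = m + (width m n : ℤ) • d ∧ det m d = 1 := by
  obtain ⟨hm, hn, hmn, hmv, hnv⟩ := h
  have htm := hΦ.mem_tightSet_of_isSide ht hm
  have htn := hΦ.mem_tightSet_of_isSide ht hn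
  rw [hΦ.mem_face_iff htm] at hmv
  rw [hΦ.mem_face_iff htn] at hnv
  set k := width m n with hk
  obtain ⟨x, hx⟩ : (k : ℤ) ∣ m.1 - n.1 := Int.gcd_dvd_left ..
  obtain ⟨y, hy⟩ : (k : ℤ) ∣ m.2 - n.2 := Int.gcd_dvd_right ..
  have hnd : n = m + (k : ℤ) • ((-x, -y) : Lattice) := by
    ext <;> simp <;> linarith
  have hdet : det m n = k * det m (-x, -y) := by
    conv_lhs => rw [hnd]
    rw [det_add_right, det_self, det_smul_right, zero_add]
  have hd0 : 0 < det m (-x, -y) := by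
    rw [hdet] at hmn
    exact pos_of_mul_pos_right hmn (Int.natCast_nonneg k)
  have hk0 : (0 : ℤ) < k := by
    rw [hdet] at hmn
    exact pos_of_mul_pos_left hmn hd0.le
  have hprim : IsPrimitive (-x, -y) := by
    have h1 : Int.gcd (m.1 - n.1) (m.2 - n.2) = k := rfl
    rw [hx, hy, Int.gcd_mul_left, Int.natAbs_natCast] at h1
    have h2 : Int.gcd x y = 1 := Nat.eq_of_mul_eq_mul_left (by exact_mod_cast hk0)
      (h1.trans (mul_one k).symm)
    simpa [IsPrimitive] using h2
  set d : Lattice := (-x, -y) with hd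
  refine ⟨d, hnd, ?_⟩
  have hdd : det m (m + d) = det m d := by rw [det_add_right, det_self, zero_add]
  -- A lattice point of the cone of `m` and `m + d` below the segment from `m` to `m + d` is
  -- excluded, and a lattice point on this segment would divide `d`.
  obtain ⟨l, hl1, hl2, hl3⟩ := hm.1.exists_det_eq_one_of_det_pos (l := m + d) (by rwa [hdd])
  have hcr := det_smul_eq m (m + d) l
  rw [hl1, one_smul, hdd] at hcr
  rw [hdd] at hl3
  set i := det l (m + d) with hi
  have hcr' : (det m d * k) • l = (i * k + k - 1) • m + (1 : ℤ) • n := by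
    rw [mul_comm, mul_smul, hcr, hnd]
    module
  have hle := hΦ.le_add_of_tight ht hmv.1 (isPrimitive_of_det_eq_one' hl1) hmv.2 hnv.2
    (by nlinarith) zero_le_one (mul_pos hd0 hk0) hcr'
  have hi1 : i = det m d - 1 := by
    have : det m d * k ≤ (i + 1) * k := by linarith
    have := le_of_mul_le_mul_right this hk0
    linarith
  have hdl : d = det m d • (l - m) := by
    rw [smul_sub, hcr, hi1]
    module
  rcases Int.isUnit_iff.1 (hprim.isUnit_of_eq_smul hdl) with h | h
  · exact h
  · linarith

/-- While there is no combinatorial change, the number of tight covectors that belong to a vertex is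
the width of the vertex. -/
theorem card_inCone_eq_width (hΦ : IsBody Φ) {a b : ℝ} (ha : 0 ≤ a) (hab : a < b)
    (hb : b ≤ finalTime Φ) {L S : Finset Lattice}
    (hc : ∀ t ∈ Set.Ioo a b, tights Φ t = L ∧ sides Φ t = S) {m n : Lattice}
    (hmn : IsNext S m n) : (L.filter (InCone m n)).card = width m n := by
  obtain ⟨t₁, ht₁⟩ := exists_between hab
  obtain ⟨t₂, ht₂⟩ := exists_between ht₁.2
  have hI₁ : t₁ ∈ Set.Ioo a b := ht₁
  have hI₂ : t₂ ∈ Set.Ioo a b := ⟨ht₁.1.trans ht₂.1, ht₂.2⟩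
  have hvert : ∀ t ∈ Set.Ioo a b, ∃ v, IsVertexBetween (propagation Φ t) m n v := fun t ht => by
    rw [hΦ.exists_isVertexBetween_iff (ha.trans_lt ht.1) (ht.2.trans_le hb), (hc t ht).2]
    exact hmn
  have hmem : ∀ t ∈ Set.Ioo a b, ∀ l, l ∈ L ↔ l ∈ tightSet Φ t := fun t ht l => by
    rw [← (hc t ht).1, hΦ.mem_tights (ha.trans_lt ht.1)]
  obtain ⟨v₁, hv₁⟩ := hvert t₁ hI₁
  obtain ⟨d, hnd, hd1⟩ := hΦ.exists_eq_add_width_smul (ha.trans_lt ht₁.1) hv₁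
  set k := width m n with hk
  have hdet : det m n = k := by
    conv_lhs => rw [hnd]
    rw [det_add_right, det_self, det_smul_right, zero_add, hd1, mul_one]
  have hd0 : d ≠ 0 := (isPrimitive_of_det_eq_one' hd1).ne_zero
  have htight : ∀ t ∈ Set.Ioo a b, ∀ {v}, IsVertexBetween (propagation Φ t) m n v →
      v ∈ propagation Φ t ∧ pairing m v = minValue Φ m + t ∧ pairing n v = minValue Φ n + t :=
    fun t ht v hv => by
      have h0 := ha.trans_lt ht.1
      have h1 := (hΦ.mem_face_iff (hΦ.mem_tightSet_of_isSide h0 hv.1)).1 hv.2.2.2.1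
      have h2 := (hΦ.mem_face_iff (hΦ.mem_tightSet_of_isSide h0 hv.2.1)).1 hv.2.2.2.2
      exact ⟨h1.1, h1.2, h2.2⟩
  have himage : L.filter (InCone m n) = (Finset.range k).image fun j : ℕ => m + (j : ℤ) • d := by
    ext l
    rw [Finset.mem_filter, Finset.mem_image]
    constructor
    · rintro ⟨hl, hc1, hc2⟩
      have hlp := ((hmem t₁ hI₁ l).1 hl).1
      -- The vertex realizes the minimum of `l` at all times, which forces `l` to lie on the segment
      -- from `m` to `n`.
      have hval : ∀ t ∈ Set.Ioo a b, (det m n : ℝ) * (minValue Φ l + t) =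
          det l n * (minValue Φ m + t) + det m l * (minValue Φ n + t) := by
        intro t ht
        obtain ⟨v, hv⟩ := hvert t ht
        obtain ⟨hvP, hvm, hvn⟩ := htight t ht hv
        have hlv : pairing l v = minValue Φ l + t := by
          rcases InCone.eq_or_det_pos hv.1.1 hlp hv.2.2.1 ⟨hc1, hc2⟩ with rfl | h0
          · exact hvm
          · refine ((hΦ.mem_face_iff ((hmem t ht l).1 hl)).1 ?_).2
            rw [face_eq_singleton hv.2.2.2.1 hv.2.2.2.2 hv.2.2.1 h0 hc2]
            rfl
        rw [← hlv, ← hvm, ← hvn]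
        exact det_mul_pairing m n l v
      have hsum : det m n = det l n + det m l := by
        have h1 := hval t₁ hI₁
        have h2 := hval t₂ hI₂
        have h3 : ((det m n : ℝ) - (det l n + det m l)) * (t₂ - t₁) = 0 := by linarith
        have h4 := (mul_eq_zero.1 h3).resolve_right (sub_ne_zero.2 ht₂.1.ne')
        have h5 : (det m n : ℝ) = det l n + det m l := sub_eq_zero.1 h4
        exact_mod_cast h5
      obtain ⟨j, hj⟩ := Int.eq_ofNat_of_zero_le hc1
      refine ⟨j, Finset.mem_range.2 (by omega), ?_⟩
      have hcr := det_smul_eq m n l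
      have hk0 : (k : ℤ) ≠ 0 := by omega
      have hdl : det l n = k - j := by omega
      rw [hdl, hdet, hj] at hcr
      have h6 : (k : ℤ) • (m + (j : ℤ) • d) = (k : ℤ) • l := by
        rw [hcr]
        conv_rhs => rw [hnd]
        module
      exact smul_right_injective Lattice hk0 h6
    · rintro ⟨j, hj, rfl⟩
      have hjk := Finset.mem_range.1 hj
      have hp : IsPrimitive (m + (j : ℤ) • d) := isPrimitive_of_det_eq_one (n := d) (by
        rw [det_add_left, det_smul_left, det_self, hd1]; simp)
      obtain ⟨hvP, hvm, hvn⟩ := htight t₁ hI₁ hv₁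
      refine ⟨(hmem t₁ hI₁ _).2 ⟨hp, v₁, hvP, ?_⟩, ?_, ?_⟩
      · refine hΦ.tight_of_tight (a := k - j) (b := j) (d := k) (ha.trans ht₁.1.le) hvP hp hvm hvn
          (by omega) (by omega) (by omega) (by omega) ?_
        conv_rhs => rw [hnd]
        module
      · rw [det_add_right, det_self, det_smul_right, hd1]; omega
      · have hdn : det d n = -1 := by
          rw [hnd, det_add_right, det_smul_right, det_self, det_swap m d, hd1]; simp
        rw [det_add_left, det_smul_left, hdet, hdn]
        omega
  rw [himage, Finset.card_image_of_injective, Finset.card_range]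
  intro i j hij
  have : (i : ℤ) • d = (j : ℤ) • d := add_left_cancel hij
  exact_mod_cast smul_left_injective ℤ hd0 this

end IsBody

/-! ### The length of the caustic -/

/-- The times, before the final time, at which the sides of slopes `m` and `n` meet in a vertex. -/
def edgeTimes (Φ : Set Plane) (m n : Lattice) : Set ℝ :=
  {t | 0 < t ∧ t < finalTime Φ ∧ IsNext (sides Φ t) m n}

/-- The weighted length of the part of the caustic that is swept by the vertices after the time `s`.
As the vertices move at unit speed, the length of an edge is its lifetime. -/
noncomputable def sweptLength (Φ : Set Plane) (s : ℝ) : ℝ :=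
  ∑ᶠ e : Lattice × Lattice,
    (width e.1 e.2 : ℝ) * MeasureTheory.volume.real (edgeTimes Φ e.1 e.2 ∩ Set.Ioi s)

/-- The length of a bounded interval. -/
theorem volume_real_of_ordConnected {A : Set ℝ} (hA : A.OrdConnected) (hne : A.Nonempty)
    (hb : BddBelow A) (ha : BddAbove A) : MeasureTheory.volume.real A = sSup A - sInf A := by
  have hconn : IsConnected A := ⟨hne, hA.isPreconnected⟩
  have h1 := hconn.Ioo_csInf_csSup_subset hb ha
  have h2 := subset_Icc_csInf_csSup hb ha
  have hle : sInf A ≤ sSup A := csInf_le_csSup hne hb ha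
  refine le_antisymm ?_ ?_
  · rw [← Real.volume_real_Icc_of_le hle]
    exact MeasureTheory.measureReal_mono h2 (by simp)
  · rw [← Real.volume_real_Ioo_of_le hle]
    exact MeasureTheory.measureReal_mono h1
      (MeasureTheory.measure_ne_top_of_subset h2 (by simp))

theorem edgeTimes_subset (Φ : Set Plane) (m n : Lattice) :
    edgeTimes Φ m n ⊆ Set.Ioo 0 (finalTime Φ) :=
  fun _ h => ⟨h.1, h.2.1⟩

theorem volume_edgeTimes_inter_ne_top (Φ : Set Plane) (m n : Lattice) (A : Set ℝ) :
    MeasureTheory.volume (edgeTimes Φ m n ∩ A) ≠ ⊤ :=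
  MeasureTheory.measure_ne_top_of_subset
    (Set.inter_subset_left.trans (edgeTimes_subset Φ m n)) (by simp)

theorem sweptLength_finalTime (Φ : Set Plane) : sweptLength Φ (finalTime Φ) = 0 := by
  have : ∀ e : Lattice × Lattice, (width e.1 e.2 : ℝ) *
      MeasureTheory.volume.real (edgeTimes Φ e.1 e.2 ∩ Set.Ioi (finalTime Φ)) = 0 := by
    intro e
    have : edgeTimes Φ e.1 e.2 ∩ Set.Ioi (finalTime Φ) = ∅ := by
      rw [Set.eq_empty_iff_forall_notMem]
      rintro r ⟨hr, h⟩
      exact lt_asymm hr.2.1 h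
    rw [this]
    simp
  rw [sweptLength, finsum_congr this, finsum_zero]

theorem perimeter_nonneg (P : Set Plane) : 0 ≤ perimeter P :=
  finsum_nonneg fun _ => finsum_nonneg fun _ => tropicalLength_nonneg _

namespace IsBody

variable {Φ : Set Plane}

/-- Two sides start to meet when all sides between them have died, and meet as long as both live. -/
theorem ordConnected_edgeTimes (hΦ : IsBody Φ) (m n : Lattice) :
    (edgeTimes Φ m n).OrdConnected := by
  refine ⟨fun a ha b hb t ht => ⟨ha.1.trans_le ht.1, ht.2.trans_lt hb.2.1, ?_, ?_, ?_, ?_⟩⟩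
  · exact hΦ.sides_antitone (ha.1.trans_le ht.1) (ht.2.trans_lt hb.2.1) ht.2 hb.2.2.1
  · exact hΦ.sides_antitone (ha.1.trans_le ht.1) (ht.2.trans_lt hb.2.1) ht.2 hb.2.2.2.1
  · exact ha.2.2.2.2.1
  · exact fun k hk => ha.2.2.2.2.2 k (hΦ.sides_antitone ha.1 ha.2.1 ht.1 hk)

/-- The tropical length of an edge of the caustic of a wave front is its lifetime. -/
theorem tropicalLength_causticEdge (hΦ : IsBody Φ) {s : ℝ} (hs : 0 < s) (hsT : s < finalTime Φ)
    (m n : Lattice) : tropicalLength (causticEdge (propagation Φ s) m n) =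
      MeasureTheory.volume.real (edgeTimes Φ m n ∩ Set.Ioi s) := by
  have hmem : ∀ p, p ∈ causticEdge (propagation Φ s) m n ↔
      ∃ t ∈ edgeTimes Φ m n ∩ Set.Ioi s, IsVertexBetween (propagation Φ t) m n p := by
    intro p
    constructor
    · rintro ⟨t, ht, htT, hv⟩
      rw [hΦ.finalTime_propagation hs hsT] at htT
      rw [hΦ.propagation_propagation hs hsT ht.le] at hv
      exact ⟨s + t, ⟨⟨by linarith, by linarith,
        (hΦ.exists_isVertexBetween_iff (by linarith) (by linarith)).1 ⟨p, hv⟩⟩,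
        lt_add_of_pos_right s ht⟩, hv⟩
    · rintro ⟨t, ⟨⟨h0, h1, -⟩, hst⟩, hv⟩
      have hst' : s < t := hst
      refine ⟨t - s, by linarith, ?_, ?_⟩
      · rw [hΦ.finalTime_propagation hs hsT]; linarith
      · rwa [hΦ.propagation_propagation hs hsT (by linarith), add_sub_cancel]
  rcases (edgeTimes Φ m n ∩ Set.Ioi s).eq_empty_or_nonempty with he | hne
  · have : causticEdge (propagation Φ s) m n = ∅ := by
      rw [Set.eq_empty_iff_forall_notMem]
      intro p hp
      obtain ⟨t, ht, -⟩ := (hmem p).1 hp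
      rw [he] at ht
      exact ht
    rw [this, he, tropicalLength_of_subsingleton Set.subsingleton_empty]
    simp
  have hvert : ∀ t ∈ edgeTimes Φ m n, ∃ p, IsVertexBetween (propagation Φ t) m n p :=
    fun t ht => (hΦ.exists_isVertexBetween_iff ht.1 ht.2.1).2 ht.2.2
  have hval : ∀ t ∈ edgeTimes Φ m n, ∀ p, IsVertexBetween (propagation Φ t) m n p →
      pairing m p = minValue Φ m + t ∧ pairing n p = minValue Φ n + t := fun t ht p hp =>
    ⟨((hΦ.mem_face_iff (hΦ.mem_tightSet_of_isSide ht.1 hp.1)).1 hp.2.2.2.1).2,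
      ((hΦ.mem_face_iff (hΦ.mem_tightSet_of_isSide ht.1 hp.2.1)).1 hp.2.2.2.2).2⟩
  obtain ⟨r, hr⟩ := hne
  obtain ⟨v, hv⟩ := hvert r hr.1
  obtain ⟨d, hnd, hd⟩ := hΦ.exists_eq_add_width_smul hr.1.1 hv
  have hmn := hv.2.2.1
  -- The velocity of the vertex is the vector on which `m` and `n` both take the value `1`.
  have hwm : pairing m (toPlane (turn d)) = 1 := by rw [pairing_turn, det_swap, hd]; simp
  have hwn : pairing n (toPlane (turn d)) = 1 := by
    rw [hnd, pairing_add_left, pairing_smul_left, hwm, pairing_turn, det_self]; simp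
  have hpos : ∀ t ∈ edgeTimes Φ m n, ∀ p, IsVertexBetween (propagation Φ t) m n p →
      p = (v - r • toPlane (turn d)) + t • toPlane (turn d) := by
    intro t ht p hp
    obtain ⟨h1, h2⟩ := hval r hr.1 v hv
    obtain ⟨h3, h4⟩ := hval t ht p hp
    refine eq_of_pairing_eq hmn.ne' ?_ ?_
    · rw [pairing_add_right, pairing_sub_right, pairing_smul_right, pairing_smul_right, hwm, h1, h3]
      ring
    · rw [pairing_add_right, pairing_sub_right, pairing_smul_right, pairing_smul_right, hwn, h2, h4]
      ring
  have himage : causticEdge (propagation Φ s) m n =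
      (fun t : ℝ => (v - r • toPlane (turn d)) + t • toPlane (turn d)) ''
        (edgeTimes Φ m n ∩ Set.Ioi s) := by
    ext p
    rw [hmem]
    constructor
    · rintro ⟨t, ht, hp⟩
      exact ⟨t, ht, (hpos t ht.1 p hp).symm⟩
    · rintro ⟨t, ht, rfl⟩
      obtain ⟨p, hp⟩ := hvert t ht.1
      obtain rfl := hpos t ht.1 p hp
      exact ⟨t, ht, hp⟩
  have hbb : BddBelow (edgeTimes Φ m n ∩ Set.Ioi s) :=
    bddBelow_Ioo.mono (Set.inter_subset_left.trans (edgeTimes_subset Φ m n))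
  have hba : BddAbove (edgeTimes Φ m n ∩ Set.Ioi s) :=
    bddAbove_Ioo.mono (Set.inter_subset_left.trans (edgeTimes_subset Φ m n))
  rw [himage, tropicalLength_image (isPrimitive_of_det_eq_one' hd).turn _ ⟨r, hr⟩ hbb hba,
    volume_real_of_ordConnected ((hΦ.ordConnected_edgeTimes m n).inter Set.ordConnected_Ioi)
      ⟨r, hr⟩ hbb hba]

theorem causticLength_propagation (hΦ : IsBody Φ) {s : ℝ} (hs : 0 < s) (hsT : s < finalTime Φ) :
    causticLength (propagation Φ s) = sweptLength Φ s + 2 * tropicalLength (finalLocus Φ) := by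
  rw [causticLength, sweptLength, hΦ.finalLocus_propagation hs hsT]
  congr 1
  exact finsum_congr fun e => by rw [hΦ.tropicalLength_causticEdge hs hsT]

/-- Only the pairs of sides at an earlier time contribute to the swept length. -/
theorem sweptLength_eq_sum (hΦ : IsBody Φ) {s t : ℝ} (hs : 0 < s) (hsT : s < finalTime Φ)
    (hst : s ≤ t) : sweptLength Φ t = ∑ e ∈ sides Φ s ×ˢ sides Φ s,
      (width e.1 e.2 : ℝ) * MeasureTheory.volume.real (edgeTimes Φ e.1 e.2 ∩ Set.Ioi t) := by
  refine finsum_eq_sum_of_support_subset _ fun e he => ?_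
  rcases (edgeTimes Φ e.1 e.2 ∩ Set.Ioi t).eq_empty_or_nonempty with h | ⟨r, hr, hrt⟩
  · rw [Function.mem_support, h] at he
    simp at he
  · have hsr : s ≤ r := hst.trans (le_of_lt hrt)
    exact Finset.mem_coe.2 (Finset.mem_product.2 ⟨hΦ.sides_antitone hs hsT hsr hr.2.2.1,
      hΦ.sides_antitone hs hsT hsr hr.2.2.2.1⟩)

theorem sweptLength_antitoneOn (hΦ : IsBody Φ) :
    AntitoneOn (sweptLength Φ) (Set.Ioo 0 (finalTime Φ)) := by
  intro s hs t _ hst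
  rw [hΦ.sweptLength_eq_sum hs.1 hs.2 hst, hΦ.sweptLength_eq_sum hs.1 hs.2 le_rfl]
  refine Finset.sum_le_sum fun e _ => mul_le_mul_of_nonneg_left ?_ (Nat.cast_nonneg _)
  exact MeasureTheory.measureReal_mono
    (Set.inter_subset_inter_right _ (Set.Ioi_subset_Ioi hst))
    (volume_edgeTimes_inter_ne_top _ _ _ _)

/-- While there is no combinatorial change, with `N` tight covectors, the caustic is swept at the
rate `N`. -/
theorem sweptLength_sub_sweptLength (hΦ : IsBody Φ) {a b : ℝ} (ha : 0 < a) (hab : a < b)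
    (hb : b ≤ finalTime Φ) {L S : Finset Lattice}
    (hc : ∀ t ∈ Set.Ioo a b, tights Φ t = L ∧ sides Φ t = S) :
    sweptLength Φ a - sweptLength Φ b = L.card * (b - a) := by
  classical
  have haT := hab.trans_le hb
  obtain ⟨c, hac, hcb⟩ := exists_between hab
  have hcI : c ∈ Set.Ioo a b := ⟨hac, hcb⟩
  have hc0 := ha.trans hac
  have hcT := hcb.trans_le hb
  have hS : IsFan S := (hc c hcI).2 ▸ hΦ.isFan_sides hc0 hcT
  have hL : ∀ k ∈ L, k ≠ 0 := fun k hk =>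
    ((hΦ.mem_tights hc0).1 ((hc c hcI).1 ▸ hk)).1.ne_zero
  have hSsub : S ⊆ sides Φ a := (hc c hcI).2 ▸ hΦ.sides_antitone ha haT hac.le
  obtain ⟨nx, hnx⟩ := hS.exists_next_fun
  have hpiece : ∀ m n : Lattice, MeasureTheory.volume.real (edgeTimes Φ m n ∩ Set.Ioi a) -
      MeasureTheory.volume.real (edgeTimes Φ m n ∩ Set.Ioi b) =
        if IsNext S m n then b - a else 0 := by
    intro m n
    have hunion : edgeTimes Φ m n ∩ Set.Ioi a =
        (edgeTimes Φ m n ∩ Set.Ioc a b) ∪ (edgeTimes Φ m n ∩ Set.Ioi b) := by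
      rw [← Set.inter_union_distrib_left, Set.Ioc_union_Ioi_eq_Ioi hab.le]
    have hdisj : Disjoint (edgeTimes Φ m n ∩ Set.Ioc a b) (edgeTimes Φ m n ∩ Set.Ioi b) :=
      Set.disjoint_left.2 fun r h1 h2 => not_lt.2 h1.2.2 h2.2
    have hae : (edgeTimes Φ m n ∩ Set.Ioc a b : Set ℝ) =ᵐ[MeasureTheory.volume]
        (edgeTimes Φ m n ∩ Set.Ioo a b : Set ℝ) :=
      (Filter.EventuallyEq.refl _ _).inter MeasureTheory.Ioo_ae_eq_Ioc.symm
    rw [hunion, MeasureTheory.measureReal_union hdisj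
      ((hΦ.ordConnected_edgeTimes m n).measurableSet.inter measurableSet_Ioi)
      (volume_edgeTimes_inter_ne_top _ _ _ _) (volume_edgeTimes_inter_ne_top _ _ _ _),
      add_sub_cancel_right, MeasureTheory.measureReal_congr hae]
    split_ifs with h
    · rw [Set.inter_eq_right.2, Real.volume_real_Ioo_of_le hab.le]
      intro r hr
      exact ⟨ha.trans hr.1, hr.2.trans_le hb, by rw [(hc r hr).2]; exact h⟩
    · have : edgeTimes Φ m n ∩ Set.Ioo a b = ∅ := by
        rw [Set.eq_empty_iff_forall_notMem]
        rintro r ⟨hr, hrI⟩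
        exact h ((hc r hrI).2 ▸ hr.2.2)
      rw [this]
      simp
  rw [hΦ.sweptLength_eq_sum ha haT le_rfl, hΦ.sweptLength_eq_sum ha haT hab.le,
    ← Finset.sum_sub_distrib]
  calc _ = ∑ m ∈ sides Φ a, ∑ n ∈ sides Φ a,
          if IsNext S m n then (width m n : ℝ) * (b - a) else 0 := by
        rw [← Finset.sum_product']
        refine Finset.sum_congr rfl fun e _ => ?_
        rw [← mul_sub, hpiece, mul_ite, mul_zero]
    _ = ∑ m ∈ S, (width m (nx m) : ℝ) * (b - a) := by
        symm
        refine Finset.sum_subset_zero_on_sdiff hSsub (fun m hm => ?_) fun m hm => ?_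
        · refine Finset.sum_eq_zero fun n _ => if_neg fun h => ?_
          exact (Finset.mem_sdiff.1 hm).2 h.1
        · rw [Finset.sum_eq_single_of_mem (nx m) (hSsub (hnx m hm).2.1), if_pos (hnx m hm)]
          intro n _ hne
          exact if_neg fun h => hne (hS.next_unique h (hnx m hm))
    _ = ((∑ m ∈ S, (L.filter (InCone m (nx m))).card : ℕ) : ℝ) * (b - a) := by
        rw [← Finset.sum_mul]
        push_cast
        congr 1
        exact Finset.sum_congr rfl fun m hm => by
          rw [hΦ.card_inCone_eq_width ha.le hab hb hc (hnx m hm)]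
    _ = _ := by
        congr 2
        simp only [Finset.card_eq_sum_ones]
        exact hS.sum_sum_inCone hnx L hL fun _ => 1

/-! ### The conserved quantity -/

/-- The sum of the perimeter of the wave front and of the length of the caustic that remains to be
swept decreases at the rate `12` while there is no combinatorial change. -/
theorem conserved_of_const (hΦ : IsBody Φ) {a b : ℝ} (ha : 0 < a) (hab : a < b)
    (hb : b ≤ finalTime Φ) {L S : Finset Lattice}
    (hc : ∀ t ∈ Set.Ioo a b, tights Φ t = L ∧ sides Φ t = S) :
    perimeter (propagation Φ a) + sweptLength Φ a + 12 * a =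
      perimeter (propagation Φ b) + sweptLength Φ b + 12 * b := by
  have h1 := hΦ.perimeter_sub_perimeter ha.le hab hb fun t ht => (hc t ht).1
  have h2 := hΦ.sweptLength_sub_sweptLength ha hab hb hc
  linarith

theorem perimeter_finalLocus (hΦ : IsBody Φ) :
    perimeter (finalLocus Φ) = 2 * tropicalLength (finalLocus Φ) := by
  obtain ⟨a, ha, haT, h⟩ := hΦ.exists_constant_before hΦ.finalTime_pos le_rfl
  obtain ⟨L, S, hc⟩ := h a le_rfl
  have hL : IsFan L := by
    obtain ⟨r, hr⟩ := exists_between haT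
    rw [← (hc r hr).1]
    exact (hΦ.isSmoothFan_tights (ha.trans hr.1) hr.2).toIsFan
  exact (hΦ.adapted_of_const ha.le haT le_rfl (fun t ht => (hc t ht).1)
    (Set.right_mem_Icc.2 haT.le)).perimeter_of_interior_eq_empty hL (convex_propagation Φ _)
      hΦ.interior_finalLocus

/-- The formula for the wave fronts at positive times. -/
theorem perimeter_add_sweptLength (hΦ : IsBody Φ) {t : ℝ} (ht : 0 < t) (htT : t < finalTime Φ) :
    perimeter (propagation Φ t) + sweptLength Φ t + 12 * t =
      2 * tropicalLength (finalLocus Φ) + 12 * finalTime Φ := by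
  set G : ℝ → ℝ := fun t => perimeter (propagation Φ t) + sweptLength Φ t + 12 * t with hG
  have hloc : ∀ t ∈ Set.Ioo 0 (finalTime Φ), G =ᶠ[𝓝 t] fun _ => G t := by
    intro t ht
    obtain ⟨a, ha, hat, h⟩ := hΦ.exists_constant_before ht.1 ht.2.le
    obtain ⟨b, htb, hbT, h'⟩ := hΦ.exists_constant_after ht.1 ht.2
    filter_upwards [Ioo_mem_nhds hat htb] with r hr
    rcases lt_trichotomy r t with hrt | rfl | hrt
    · obtain ⟨L, S, hc⟩ := h r hr.1.le
      exact hΦ.conserved_of_const (ha.trans hr.1) hrt ht.2.le hc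
    · rfl
    · obtain ⟨L, S, hc⟩ := h' r hr.2.le
      exact (hΦ.conserved_of_const ht.1 hrt (hr.2.trans hbT).le hc).symm
  have hder : ∀ t ∈ Set.Ioo 0 (finalTime Φ), HasDerivAt G 0 t := fun t ht =>
    (hasDerivAt_const t (G t)).congr_of_eventuallyEq (hloc t ht)
  obtain ⟨a, ha, haT, h⟩ := hΦ.exists_constant_before hΦ.finalTime_pos le_rfl
  obtain ⟨L, S, hc⟩ := h a le_rfl
  have h1 : G a = G (finalTime Φ) := hΦ.conserved_of_const ha haT le_rfl hc
  have h2 : G t = G a := isOpen_Ioo.is_const_of_deriv_eq_zero isPreconnected_Ioo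
    (fun x hx => (hder x hx).differentiableAt.differentiableWithinAt)
    (fun x hx => (hder x hx).deriv) ⟨ht, htT⟩ ⟨ha, haT⟩
  have h3 : G (finalTime Φ) = 2 * tropicalLength (finalLocus Φ) + 12 * finalTime Φ := by
    simp only [hG]
    rw [sweptLength_finalTime, add_zero, ← hΦ.perimeter_finalLocus, finalLocus]
  exact h2.trans (h1.trans h3)

end IsBody

end Tropical2D

theorem mainTheorem3 (Φ : Set Tropical2D.Plane) (hconv : Convex ℝ Φ) (hcomp : IsCompact Φ)
    (hint : (interior Φ).Nonempty) :
    ∃ lK lB : ℝ,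
      Tendsto (fun t : ℝ => Tropical2D.causticLength (Tropical2D.propagation Φ t))
        (𝓝[>] 0) (𝓝 lK) ∧
      Tendsto (fun t : ℝ => Tropical2D.perimeter (Tropical2D.propagation Φ t))
        (𝓝[>] 0) (𝓝 lB) ∧
      lK + lB =
        12 * Tropical2D.finalTime Φ + 4 * Tropical2D.tropicalLength (Tropical2D.finalLocus Φ) := by
  have hΦ : Tropical2D.IsBody Φ := ⟨hconv, hcomp, hint⟩
  have hT := hΦ.finalTime_pos
  have hIoo : Set.Ioo 0 (Tropical2D.finalTime Φ) ∈ 𝓝[>] (0 : ℝ) := Ioo_mem_nhdsGT hT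
  set l := Tropical2D.tropicalLength (Tropical2D.finalLocus Φ) with hl
  -- The swept length increases as `t` decreases to `0`, and it is bounded by the conserved
  -- quantity.
  have hbdd : BddAbove (Tropical2D.sweptLength Φ '' Set.Ioo 0 (Tropical2D.finalTime Φ)) := by
    refine ⟨2 * l + 12 * Tropical2D.finalTime Φ, ?_⟩
    rintro _ ⟨t, ht, rfl⟩
    have h1 := hΦ.perimeter_add_sweptLength ht.1 ht.2
    have h2 := Tropical2D.perimeter_nonneg (Tropical2D.propagation Φ t)
    have h3 := ht.1
    linarith
  obtain ⟨K, hK⟩ : ∃ K, Tendsto (Tropical2D.sweptLength Φ) (𝓝[>] 0) (𝓝 K) :=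
    ⟨_, hΦ.sweptLength_antitoneOn.tendsto_nhdsWithin_Ioo_right (Set.nonempty_Ioo.2 hT) hbdd⟩
  refine ⟨K + 2 * l, 2 * l + 12 * Tropical2D.finalTime Φ - K, ?_, ?_, by ring⟩
  · refine (hK.add_const (2 * l)).congr' ?_
    filter_upwards [hIoo] with t ht
    exact (hΦ.causticLength_propagation ht.1 ht.2).symm
  · have h12 : Tendsto (fun t : ℝ => 12 * t) (𝓝[>] 0) (𝓝 0) := by
      have : Tendsto (fun t : ℝ => 12 * t) (𝓝 0) (𝓝 (12 * 0)) :=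
        (continuous_const.mul continuous_id).tendsto 0
      rw [mul_zero] at this
      exact this.mono_left nhdsWithin_le_nhds
    have := (hK.const_sub (2 * l + 12 * Tropical2D.finalTime Φ)).sub h12
    rw [sub_zero] at this
    refine this.congr' ?_
    filter_upwards [hIoo] with t ht
    linarith [hΦ.perimeter_add_sweptLength ht.1 ht.2]
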